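/- Let $\mathfrak g$ be a finite-dimensional complex simple Lie algebra, $\mathfrak h$ a Cartan subalgebra, and fix a system of simple roots, with positive roots $\Phi^+$ and $\rho=\frac12\sum_{\alpha\in\Phi^+}\alpha$. Let $\langle\cdot,\cdot\rangle$ be the symmetric bilinear form on $\mathfrak h^*$ induced by the Killing form, or any scalar multiple of it (for instance the one for which long roots $\alpha$ have $\langle\alpha,\alpha\rangle=2$). Let $h$ be the Coxeter number of $\mathfrak g$, that is, the order of a Coxeter element (a product, in any order, of the reflections in the simple roots, each taken once) of the Weyl group. For every finite-dimensional irreducible representation $V_\lambda$ of $\mathfrak g$ of highest weight $\lambda\in\mathfrak h^*$, the expected norm of a weight in $V_\lambda$ is $$\frac{1}{\dim V_\lambda}\sum_{\mu}\dim\big(V_\lambda(\mu)\big)\,\langle\mu,\mu\rangle=\frac{1}{h+1}\,\langle\lambda,\lambda+2\rho\rangle,$$ where $\mu$ runs over the weights of $V_\lambda$ and $V_\lambda(\mu)=\{v\in V_\lambda : Hv=\mu(H)v\ \text{for all } H\in\mathfrak h\}$ is the $\mu$-weight space. -/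

import Mathlib

noncomputable section

/-- A Coxeter element of the Weyl group of a root pairing: the product, in some order, of the
reflections in the simple roots of some base, each occurring exactly once. The Coxeter number is
the order of any such element. -/
def RootPairing.IsCoxeterElement {ι R M N : Type*} [CommRing R] [AddCommGroup M] [Module R M]
    [AddCommGroup N] [Module R N] (P : RootPairing ι R M N) (w : M ≃ₗ[R] M) : Prop :=
  ∃ (b : P.Base) (l : List ι), l.Nodup ∧ (∀ i, i ∈ l ↔ i ∈ b.support) ∧
    w = (l.map P.reflection).prod

namespace LieAlgebra

variable {L : Type*} [LieRing L] [LieAlgebra ℂ L] [FiniteDimensional ℂ L] [IsKilling ℂ L]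
  (H : LieSubalgebra ℂ L) [H.IsCartanSubalgebra]

/-- The symmetric bilinear form on `H*` induced by the Killing form of `L`: the restriction of the
Killing form to `H` is non-degenerate, so it identifies `H` with `H*`, and it is transported
along this identification. -/
def dualKillingForm : LinearMap.BilinForm ℂ (Module.Dual ℂ H) :=
  ((killingForm ℂ L).restrict H.toSubmodule).compl₁₂
    (IsKilling.cartanEquivDual H).symm.toLinearMap
    (IsKilling.cartanEquivDual H).symm.toLinearMap

variable {H}

open scoped Classical in
/-- Half the sum of the positive roots, relative to a base. -/
def halfSumPositiveRoots (b : (IsKilling.rootSystem H).Base) : Module.Dual ℂ H :=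
  (1 / 2 : ℂ) • ∑ i with b.IsPos i, (IsKilling.rootSystem H).root i

/-- `lam` is a highest weight of the `L`-module `V`, relative to a base of the root system: some
nonzero vector of weight `lam` is killed by all positive root spaces. -/
def IsHighestWeight (b : (IsKilling.rootSystem H).Base)
    (V : Type*) [AddCommGroup V] [Module ℂ V] [LieRingModule L V] [LieModule ℂ L V]
    (lam : Module.Dual ℂ H) : Prop :=
  ∃ v ∈ LieModule.weightSpace V (lam : H → ℂ), v ≠ 0 ∧
    ∀ i, b.IsPos i → ∀ x ∈ rootSpace H ((IsKilling.rootSystem H).root i), ⁅x, v⁆ = 0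

end LieAlgebra

end

/-!
Fix the Killing form `κ` of `L`, let `n` be the rank and let `Φ` be the set of roots. All the
quantities in the theorem are read off from the Casimir operator `Ω = ∑ a, x a * y a` of `V`, for
families `x`, `y` that are dual for `κ` and adapted to the root space decomposition.

* `Ω` commutes with `L`, so on the irreducible module `V` it is the scalar by which it acts on the
  highest weight vector, `⟨λ, λ + 2ρ⟩`
  (`LieAlgebra.sum_lie_lie_rootFamily_of_isPos_lie_eq_zero`). Its trace is `dim V * ⟨λ, λ + 2ρ⟩`.
* As `L` is simple, the trace form of `V` is `c • κ` for some scalar `c`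
  (`LieModule.exists_traceForm_eq_smul_killingForm`). Hence the trace of `Ω` is `c * dim L`, which
  is `c * (n + |Φ|)`.
* The part of `Ω` coming from the Cartan subalgebra acts on the weight space of `μ` by `⟨μ, μ⟩`, so
  its trace is the sum in the theorem; by the trace form it equals `c * n`. Here the weight spaces
  and the generalized weight spaces coincide (`LieAlgebra.weightSpace_eq_genWeightSpace`).

The theorem follows by comparison from `|Φ| = n * h`, which is
`RootPairing.IsCoxeterElement.card_eq_orderOf_mul_finrank`. To prove it, use that the Dynkin diagram
is a forest. Therefore all Coxeter elements for a given base are conjugate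
(`isConj_prod_of_forest`), and the diagram has a 2-colouring, so that `w` may be taken to be the
product of the reflections of one colour by those of the other. The Perron-Frobenius eigenvector of
the Cartan matrix, together with the colouring, determines the Coxeter plane: a plane of functionals
on which `w` acts by a rotation, containing one that is positive on all the positive roots. It
follows that each orbit of `w` on `Φ` has `h` elements, exactly one of which is positive with
negative image, and there are exactly `n` such roots
(`RootPairing.Base.card_eq_orderOf_mul_card_of_bipartite`).
-/

/-! ### Products of simple reflections -/

namespace RootPairing

variable {ι R M N : Type*} [CommRing R] [AddCommGroup M] [Module R M] [AddCommGroup N] [Module R N]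

lemma root_prod_reflectionPerm (P : RootPairing ι R M N) (l : List ι) (i : ι) :
    P.root ((l.map P.reflectionPerm).prod i) = (l.map P.reflection).prod (P.root i) := by
  induction l with
  | nil => simp
  | cons j l ih =>
    simp only [List.map_cons, List.prod_cons, Equiv.Perm.mul_apply, LinearEquiv.mul_apply, ← ih]
    exact P.root_reflectionPerm j _

lemma inv_prod_reflectionPerm (P : RootPairing ι R M N) (l : List ι) :
    ((l.map P.reflectionPerm).prod)⁻¹ = (l.reverse.map P.reflectionPerm).prod := by
  rw [List.prod_inv_reverse, List.map_map, List.map_reverse]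
  congr 3
  ext1 i
  simp

lemma commute_reflectionPerm (P : RootPairing ι R M N) {i j : ι} (h : P.IsOrthogonal i j) :
    Commute (P.reflectionPerm i) (P.reflectionPerm j) := by
  ext k
  apply P.root.injective
  have := DFunLike.congr_fun (isOrthogonal_comm P i j h).eq (P.root k)
  simpa only [root_reflectionPerm, Equiv.Perm.mul_apply, LinearEquiv.mul_apply] using this

lemma orderOf_prod_reflectionPerm (P : RootPairing ι R M N) [P.IsRootSystem] (l : List ι) :
    orderOf (l.map P.reflectionPerm).prod = orderOf (l.map P.reflection).prod := by
  have key (k : ℕ) (i : ι) : P.root (((l.map P.reflectionPerm).prod ^ k) i) =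
      ((l.map P.reflection).prod ^ k) (P.root i) := by
    induction k with
    | zero => simp
    | succ k ih =>
      rw [pow_succ', pow_succ', Equiv.Perm.mul_apply, root_prod_reflectionPerm, ih]
      rfl
  refine orderOf_eq_orderOf_iff.mpr fun k ↦ ⟨fun h ↦ ?_, fun h ↦ ?_⟩
  · ext x
    have hx : x ∈ Submodule.span R (Set.range P.root) := by
      rw [IsRootSystem.span_root_eq_top]; trivial
    induction hx using Submodule.span_induction with
    | mem x hx => obtain ⟨i, rfl⟩ := hx; rw [← key, h]; rfl
    | zero => simp
    | add x y _ _ hx hy => rw [map_add, hx, hy, map_add]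
    | smul c x _ hx => rw [map_smul, hx, map_smul]
  · ext i
    apply P.root.injective
    rw [key, h]
    rfl

/-- `w ρ_a w⁻¹ = ρ_{w a}`, for `w` a product of reflections. -/
lemma reflectionPerm_prod_apply (P : RootPairing ι R M N) (l : List ι) (a : ι) :
    P.reflectionPerm ((l.map P.reflectionPerm).prod a) * (l.map P.reflectionPerm).prod =
      (l.map P.reflectionPerm).prod * P.reflectionPerm a := by
  induction l with
  | nil => simp
  | cons j l ih =>
    have hrefl (k : ι) : P.reflectionPerm (P.reflectionPerm j k) =
        P.reflectionPerm j * P.reflectionPerm k * P.reflectionPerm j := by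
      ext i
      apply P.root.injective
      simp only [Equiv.Perm.mul_apply, root_reflectionPerm, reflection_reflectionPerm,
        LinearEquiv.mul_apply]
    simp only [List.map_cons, List.prod_cons, Equiv.Perm.mul_apply, hrefl]
    calc _ = P.reflectionPerm j * P.reflectionPerm ((l.map P.reflectionPerm).prod a) *
          (P.reflectionPerm j ^ 2 * (l.map P.reflectionPerm).prod) := by simp only [sq, mul_assoc]
      _ = _ := by rw [reflectionPerm_sq, one_mul, mul_assoc, ih, mul_assoc]

lemma prod_reflectionPerm_eq_self (P : RootPairing ι R M N) {l : List ι} {i : ι}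
    (h : ∀ j ∈ l, P.pairing i j = 0) : (l.map P.reflectionPerm).prod i = i := by
  induction l with
  | nil => simp
  | cons j l ih =>
    simp [ih fun k hk ↦ h k (by simp [hk]),
      P.reflectionPerm_eq_of_pairing_eq_zero (h j (by simp))]

/-- The product of the reflections in pairwise orthogonal roots negates those roots. -/
lemma prod_reflectionPerm_of_mem (P : RootPairing ι R M N) {l : List ι} (hnd : l.Nodup)
    (horth : ∀ i ∈ l, ∀ j ∈ l, i ≠ j → P.pairing i j = 0) {i : ι} (hi : i ∈ l) :
    (l.map P.reflectionPerm).prod i = P.reflectionPerm i i := by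
  induction l with
  | nil => simp at hi
  | cons j l ih =>
    rw [List.nodup_cons] at hnd
    rw [List.map_cons, List.prod_cons, Equiv.Perm.mul_apply]
    rcases List.mem_cons.mp hi with rfl | hi
    · rw [P.prod_reflectionPerm_eq_self fun k hk ↦
        horth i (by simp) k (by simp [hk]) fun h ↦ hnd.1 (h ▸ hk)]
    · have hij : i ≠ j := fun h ↦ hnd.1 (h ▸ hi)
      rw [ih hnd.2 (fun i hi k hk ↦ horth i (by simp [hi]) k (by simp [hk])) hi]
      apply P.root.injective
      have := P.reflectionPerm_eq_of_pairing_eq_zero (horth i (by simp [hi]) j (by simp) hij)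
      rw [root_reflectionPerm, root_reflectionPerm, reflection_apply_self, map_neg,
        ← root_reflectionPerm, this]

namespace Base

variable {P : RootPairing ι R M N} [CharZero R]

lemma isPos_reflectionPerm_self_iff (b : P.Base) (i : ι) :
    b.IsPos (P.reflectionPerm i i) ↔ ¬ b.IsPos i :=
  IsPos.neg_iff_not b i

variable [Finite ι] [IsDomain R] [P.IsCrystallographic] [P.IsReduced] {b : P.Base}

/-- Let `w` be a product of simple reflections. A positive root made negative by `w⁻¹` is the image
of the simple root of some factor of `w` under the product of the preceding factors. -/
lemma IsPos.exists_eq_of_not_isPos_inv {l : List ι} (hl : ∀ j ∈ l, j ∈ b.support) {i : ι}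
    (hi : b.IsPos i) (hneg : ¬ b.IsPos ((l.map P.reflectionPerm).prod⁻¹ i)) :
    ∃ l₁ a l₂, l = l₁ ++ a :: l₂ ∧ (l₁.map P.reflectionPerm).prod a = i := by
  induction l generalizing i with
  | nil => simp [hi] at hneg
  | cons c l ih =>
    by_cases hic : i = c
    · exact ⟨[], c, l, by simp, by simp [hic]⟩
    · have hpos := hi.reflectionPerm (hl c (by simp)) hic
      obtain ⟨l₁, a, l₂, rfl, ha⟩ := ih (fun j hj ↦ hl j (by simp [hj])) hpos (by
        simpa [mul_inv_rev, Equiv.Perm.mul_apply] using hneg)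
      exact ⟨c :: l₁, a, l₂, by simp, by simp [ha]⟩

/-- The Weyl group acts freely on the set of bases: a product of simple reflections which maps
positive roots to positive roots is the identity. By the exchange property a longer such product
equals a product with two factors fewer; `n` bounds the length for this induction. -/
lemma prod_reflectionPerm_eq_one (n : ℕ) {l : List ι} (hn : l.length ≤ n)
    (hl : ∀ j ∈ l, j ∈ b.support)
    (hpos : ∀ i, b.IsPos i → b.IsPos ((l.map P.reflectionPerm).prod i)) :
    (l.map P.reflectionPerm).prod = 1 := by
  induction n generalizing l with
  | zero => simp_all
  | succ n ih =>
    match l with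
    | [] => simp
    | c :: l =>
      have hc : b.IsPos c := isPos_of_mem_support (hl c (by simp))
      have hneg : ¬ b.IsPos ((l.map P.reflectionPerm).prod⁻¹ c) := by
        intro h
        have := hpos _ h
        rw [List.map_cons, List.prod_cons, ← Equiv.Perm.mul_apply, mul_inv_cancel_right,
          isPos_reflectionPerm_self_iff] at this
        exact this hc
      obtain ⟨l₁, a, l₂, rfl, ha⟩ :=
        hc.exists_eq_of_not_isPos_inv (fun j hj ↦ hl j (by simp [hj])) hneg
      have key : ((c :: (l₁ ++ a :: l₂)).map P.reflectionPerm).prod =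
          ((l₁ ++ l₂).map P.reflectionPerm).prod := by
        have := P.reflectionPerm_prod_apply l₁ a
        rw [ha] at this
        simp only [List.map_cons, List.prod_cons, List.map_append, List.prod_append]
        rw [← mul_assoc, this, mul_assoc, ← mul_assoc (P.reflectionPerm a), ← sq,
          reflectionPerm_sq, one_mul]
      rw [key]
      refine ih ?_ (fun j hj ↦ hl j ?_) fun i hi ↦ by rw [← key]; exact hpos i hi
      · simp at hn ⊢; omega
      · simp only [List.mem_append, List.mem_cons] at hj ⊢; tauto

/-- The product of the reflections in pairwise orthogonal simple roots permutes the other positive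
roots. -/
lemma IsPos.prod_reflectionPerm {l : List ι} (hl : ∀ j ∈ l, j ∈ b.support) (hnd : l.Nodup)
    (horth : ∀ i ∈ l, ∀ j ∈ l, i ≠ j → P.pairing i j = 0) {i : ι} (hi : b.IsPos i) (hil : i ∉ l) :
    b.IsPos ((l.map P.reflectionPerm).prod i) := by
  by_contra hneg
  rw [← inv_inv (l.map P.reflectionPerm).prod, inv_prod_reflectionPerm] at hneg
  obtain ⟨l₁, a, l₂, h, ha⟩ := hi.exists_eq_of_not_isPos_inv (by simpa using hl) hneg
  have hl' : l = l₂.reverse ++ a :: l₁.reverse := by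
    rw [← List.reverse_reverse l, h]; simp
  have hal₁ : a ∉ l₁ := by
    rw [hl'] at hnd
    have := (List.nodup_append.mp hnd).2.1
    simpa using (List.nodup_cons.mp this).1
  have hfix : (l₁.map P.reflectionPerm).prod a = a :=
    P.prod_reflectionPerm_eq_self fun j hj ↦
      horth a (by simp [hl']) j (by simp [hl', hj]) fun h ↦ hal₁ (h ▸ hj)
  exact hil (by rw [← ha, hfix, hl']; simp)

end Base

end RootPairing

/-! ### Reordering a product whose commutation graph is a forest -/

/-- Suppose `f i` and `f j` commute unless `i` and `j` are adjacent for `adj`, where every nonempty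
subset of `S` has an element with at most one neighbour in that subset. Then all products of the
`f i`, `i ∈ S`, each taken once, are conjugate: for a leaf `v` with neighbour `u`, the factor `f v`
commutes with all others but `f u`, so up to conjugation it can be moved next to `f u` and merged
with it. -/
lemma isConj_prod_of_forest {ι G : Type*} [DecidableEq ι] [Group G] (adj : ι → ι → Prop)
    (S : Finset ι)
    (hforest : ∀ T ⊆ S, T.Nonempty → ∃ v ∈ T, ∃ u, ∀ j ∈ T, j ≠ v → j ≠ u → ¬ adj v j)
    (f : ι → G) (hf : ∀ i ∈ S, ∀ j ∈ S, ¬ adj i j → Commute (f i) (f j))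
    {l l' : List ι} (hl : l.Nodup) (hl' : l'.Nodup) (hlS : ∀ i, i ∈ l ↔ i ∈ S)
    (hlS' : ∀ i, i ∈ l' ↔ i ∈ S) :
    IsConj (l.map f).prod (l'.map f).prod := by
  induction hn : S.card generalizing S f l l' with
  | zero =>
    obtain rfl : S = ∅ := Finset.card_eq_zero.mp hn
    obtain rfl : l = [] := List.eq_nil_iff_forall_not_mem.mpr fun i hi ↦ by simpa using (hlS i).1 hi
    obtain rfl : l' = [] :=
      List.eq_nil_iff_forall_not_mem.mpr fun i hi ↦ by simpa using (hlS' i).1 hi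
    exact IsConj.refl _
  | succ n ih =>
    obtain ⟨v, hvS, u, hu⟩ := hforest S subset_rfl (Finset.card_pos.mp (by omega))
    rcases (S.erase v).eq_empty_or_nonempty with hS | hS
    · have single (l : List ι) (hl : l.Nodup) (hlS : ∀ i, i ∈ l ↔ i ∈ S) : l = [v] := by
        refine List.perm_singleton.mp ((List.perm_ext_iff_of_nodup hl (by simp)).mpr fun i ↦ ?_)
        have := Finset.ext_iff.mp hS i
        simp only [Finset.mem_erase, Finset.notMem_empty, iff_false, not_and', not_not] at this
        rw [hlS, List.mem_singleton]
        exact ⟨this, fun h ↦ h ▸ hvS⟩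
      rw [single l hl hlS, single l' hl' hlS']
    -- If `v` is isolated in `S`, any other vertex can play the role of its neighbour.
    obtain ⟨u, huS, hu⟩ : ∃ u ∈ S.erase v, ∀ j ∈ S, j ≠ v → j ≠ u → ¬ adj v j := by
      by_cases h : u ∈ S.erase v
      · exact ⟨u, h, hu⟩
      · obtain ⟨u', hu'⟩ := hS
        exact ⟨u', hu', fun j hj hjv _ ↦ hu j hj hjv fun hju ↦ h (by simp [← hju, hj, hjv])⟩
    obtain ⟨huv, huS'⟩ := Finset.mem_erase.mp huS
    have hcomm (j : ι) (hj : j ∈ S) (hju : j ≠ u) : Commute (f v) (f j) := by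
      by_cases hjv : j = v
      · rw [hjv]
      · exact hf v hvS j hj (hu j hj hjv hju)
    have hcomml (l : List ι) (hl : ∀ j ∈ l, j ∈ S ∧ j ≠ u) : Commute (f v) (l.map f).prod :=
      Commute.list_prod_right _ _ fun x hx ↦ by
        obtain ⟨j, hj, rfl⟩ := List.mem_map.mp hx
        exact hcomm j (hl j hj).1 (hl j hj).2
    -- Merge the leaf `v` into its neighbour `u`.
    let f' : ι → G := Function.update f u (f u * f v)
    have hf'u : f' u = f u * f v := by simp [f']
    have hf'map (l : List ι) (hl : u ∉ l) : l.map f' = l.map f :=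
      List.map_congr_left fun j hj ↦ Function.update_of_ne (fun h : j = u ↦ hl (h ▸ hj)) _ _
    have merge (l : List ι) (hl : l.Nodup) (hlS : ∀ i, i ∈ l ↔ i ∈ S) :
        IsConj (l.map f).prod ((l.erase v).map f').prod := by
      obtain ⟨a, b, rfl⟩ := List.append_of_mem ((hlS u).2 huS')
      have hua : u ∉ a ∧ u ∉ b := by
        rw [List.nodup_append] at hl
        exact ⟨fun h ↦ hl.2.2 u h u (by simp) rfl, (List.nodup_cons.mp hl.2.1).1⟩
      have hmem (c : List ι) (hc : c ⊆ a ++ b) : ∀ j ∈ c, j ∈ S ∧ j ≠ u := fun j hj ↦ by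
        have := hc hj
        refine ⟨(hlS j).1 ?_, fun h ↦ ?_⟩
        · simp only [List.mem_append, List.mem_cons] at this ⊢; tauto
        · subst h; simp [hua] at this
      have hv : v ∈ a ++ u :: b := (hlS v).2 hvS
      by_cases hva : v ∈ a
      · obtain ⟨a₁, a₂, rfl⟩ := List.append_of_mem hva
        have hva₁ : v ∉ a₁ := fun h ↦ by
          rw [List.append_assoc, List.nodup_append] at hl
          exact hl.2.2 v h v (by simp) rfl
        have herase : (a₁ ++ v :: a₂ ++ u :: b).erase v = a₁ ++ a₂ ++ u :: b := by
          rw [List.append_assoc, List.erase_append_right _ hva₁]; simp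
        have h₁ := hcomml a₁ (hmem _ fun j hj ↦ by simp [hj])
        have h₂ := hcomml b (hmem _ fun j hj ↦ by simp [hj])
        rw [herase]
        simp only [List.map_append, List.map_cons, List.prod_append, List.prod_cons, hf'u,
          hf'map a₁ fun h ↦ hua.1 (by simp [h]), hf'map a₂ fun h ↦ hua.1 (by simp [h]),
          hf'map b hua.2]
        refine isConj_iff.mpr ⟨(f v)⁻¹, ?_⟩
        rw [inv_inv]
        calc _ = (f v)⁻¹ * ((a₁.map f).prod * f v) * (a₂.map f).prod * f u *
              ((b.map f).prod * f v) := by group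
          _ = _ := by rw [← h₁.eq, ← h₂.eq]; group
      · have hvb : v ∈ b := by
          simp only [List.mem_append, List.mem_cons, hva, huv.symm, false_or] at hv; exact hv
        obtain ⟨b₁, b₂, rfl⟩ := List.append_of_mem hvb
        have hvb₁ : v ∉ b₁ := fun h ↦ by
          rw [List.nodup_append, List.nodup_cons, List.nodup_append] at hl
          exact hl.2.1.2.2.2 v h v (by simp) rfl
        have herase : (a ++ u :: (b₁ ++ v :: b₂)).erase v = a ++ u :: (b₁ ++ b₂) := by
          rw [List.erase_append_right _ hva, List.erase_cons_tail (by simpa using huv),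
            List.erase_append_right _ hvb₁]
          simp
        have h₁ := hcomml b₁ (hmem _ fun j hj ↦ by simp [hj])
        rw [herase]
        simp only [List.map_append, List.map_cons, List.prod_append, List.prod_cons, hf'u,
          hf'map a hua.1, hf'map b₁ fun h ↦ hua.2 (by simp [h]),
          hf'map b₂ fun h ↦ hua.2 (by simp [h])]
        rw [← mul_assoc _ (f v), ← h₁.eq]
        simp only [mul_assoc]
        exact IsConj.refl _
    have hlS₀ (l : List ι) (hl : l.Nodup) (hlS : ∀ i, i ∈ l ↔ i ∈ S) (i : ι) :
        i ∈ l.erase v ↔ i ∈ S.erase v := by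
      rw [hl.mem_erase_iff, Finset.mem_erase, hlS]
    refine (merge l hl hlS).trans (IsConj.trans ?_ (merge l' hl' hlS').symm)
    refine ih (S.erase v) (fun T hT ↦ hforest T (hT.trans (S.erase_subset v))) f' ?_
      (hl.erase v) (hl'.erase v) (hlS₀ l hl hlS) (hlS₀ l' hl' hlS')
      (by rw [Finset.card_erase_of_mem hvS, hn]; rfl)
    have hu' (j : ι) (hj : j ∈ S.erase v) (hju : j ≠ u) (h : Commute (f u) (f j)) :
        Commute (f' u) (f' j) := by
      rw [hf'u, show f' j = f j from Function.update_of_ne hju _ _]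
      exact h.mul_left (hcomm j (Finset.mem_of_mem_erase hj) hju)
    intro i hi j hj hij
    have hij' := hf i (Finset.mem_of_mem_erase hi) j (Finset.mem_of_mem_erase hj) hij
    by_cases hiu : i = u <;> by_cases hju : j = u
    · rw [hiu, hju]
    · subst hiu; exact hu' j hj hju hij'
    · subst hju; exact (hu' i hi hiu hij'.symm).symm
    · simpa [f', hiu, hju] using hij'

/-! ### The Cartan matrix: acyclicity, bipartition and positive eigenvector -/

open Matrix in
/-- The Gram matrix of the simple roots for the form `∑ₖ ⟨·, αₖ^∨⟩²`, as a real matrix. -/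
lemma RootPairing.Base.exists_gram {ι R M N : Type*} [Finite ι] [CommRing R] [CharZero R]
    [IsDomain R] [AddCommGroup M] [Module R M] [AddCommGroup N] [Module R N]
    {P : RootPairing ι R M N} [P.IsRootSystem] [P.IsCrystallographic] (b : P.Base) :
    ∃ g : Matrix b.support b.support ℝ, g.PosDef ∧
      ∀ i j, 2 * g i j = b.cartanMatrix i j * g j j := by
  classical
  have := Fintype.ofFinite ι
  let C : Matrix b.support ι ℝ := .of fun i k ↦ (P.pairingIn ℤ i k : ℝ)
  have hgram (i j : b.support) : (C * Cᴴ) i j =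
      ((∑ k, P.pairingIn ℤ i k * P.pairingIn ℤ j k : ℤ) : ℝ) := by
    simp [Matrix.mul_apply, C]
  refine ⟨C * Cᴴ, PosDef.mul_conjTranspose_self _ fun x y hxy ↦ ?_, fun i j ↦ ?_⟩
  · rw [← sub_eq_zero] at hxy ⊢
    rw [← sub_vecMul] at hxy
    have hdet : (b.cartanMatrix.map (Int.castRingHom ℝ)).det ≠ 0 := by
      have := (Matrix.nondegenerate_iff_det_ne_zero).mp b.cartanMatrix_nondegenerate
      rw [← RingHom.mapMatrix_apply, ← RingHom.map_det]
      simpa using this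
    refine Matrix.eq_zero_of_vecMul_eq_zero hdet ?_
    ext k
    simpa [C, vecMul, dotProduct, cartanMatrixIn_def] using congr_fun hxy k
  · rw [hgram, hgram]
    norm_cast
    apply FaithfulSMul.algebraMap_injective ℤ R
    have := RootPairing.InvariantForm.two_mul_apply_root_root P.toInvariantForm (i : ι) j
    simp only [map_mul, map_sum, map_ofNat, cartanMatrixIn_def, algebraMap_pairingIn]
    simpa [rootForm_apply_apply] using this

namespace Matrix

variable {n : Type*} [Fintype n] [DecidableEq n] {A : Matrix n n ℤ} {g : Matrix n n ℝ}

/-- The Dynkin diagram of a Cartan matrix of finite type is a forest: every set of vertices has a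
vertex with at most one neighbour in the set. Otherwise the sum of the normalized simple roots in
the set would have non-positive square length. -/
lemma exists_leaf_of_posDef (hg : g.PosDef) (hA : ∀ i j, 2 * g i j = A i j * g j j)
    (hA0 : ∀ i j, i ≠ j → A i j ≤ 0) (T : Finset n) (hT : T.Nonempty) :
    ∃ v ∈ T, ∃ u, ∀ j ∈ T, j ≠ v → j ≠ u → A v j = 0 := by
  by_contra! hc
  have hpos (i : n) : 0 < g i i := hg.diag_pos
  have hsymm (i j : n) : g i j = g j i := by simpa using (hg.isHermitian.apply i j).symm
  set s : n → ℝ := fun i ↦ Real.sqrt (g i i) with hs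
  have hspos (i : n) : 0 < s i := Real.sqrt_pos.mpr (hpos i)
  have hsq (i : n) : s i * s i = g i i := Real.mul_self_sqrt (hpos i).le
  have hnonpos (i j : n) (hij : i ≠ j) : g i j ≤ 0 := by
    have h₁ : (A i j : ℝ) ≤ 0 := by exact_mod_cast hA0 i j hij
    nlinarith [hA i j, hpos j]
  have hedge (i j : n) (hij : i ≠ j) (h : A i j ≠ 0) : g i j / (s i * s j) ≤ -(1 / 2) := by
    have hji : A j i ≠ 0 := fun h' ↦ h <| by
      have h₁ := hA j i
      rw [h', hsymm] at h₁
      have h₂ := hA i j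
      have : (A i j : ℝ) * g j j = 0 := by rw [← h₂, h₁]; simp
      simpa [(hpos j).ne'] using this
    have h₁ : (A i j : ℝ) ≤ -1 := by
      exact_mod_cast (by have := hA0 i j hij; omega : A i j ≤ -1)
    have h₂ : (A j i : ℝ) ≤ -1 := by
      exact_mod_cast (by have := hA0 j i hij.symm; omega : A j i ≤ -1)
    have h₃ := hA i j
    have h₄ := hA j i
    rw [hsymm] at h₄
    have hij' := hnonpos i j hij
    have hss : 0 < s i * s j := mul_pos (hspos i) (hspos j)
    rw [div_le_iff₀ hss]
    have h₅ : g j j ≤ -(2 * g i j) := by nlinarith [hpos j]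
    have h₆ : g i i ≤ -(2 * g i j) := by nlinarith [hpos i]
    have h₇ : (s i * s j) ^ 2 ≤ (-(2 * g i j)) ^ 2 := by
      calc (s i * s j) ^ 2 = g i i * g j j := by rw [← hsq, ← hsq]; ring
        _ ≤ (-(2 * g i j)) * (-(2 * g i j)) :=
          mul_le_mul h₆ h₅ (hpos j).le (by linarith)
        _ = _ := by ring
    have := abs_le_of_sq_le_sq' h₇ (by linarith)
    linarith [this.2]
  let x : n → ℝ := fun i ↦ if i ∈ T then (s i)⁻¹ else 0
  have hx : x ≠ 0 := fun h ↦ by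
    obtain ⟨i, hi⟩ := hT
    have := congr_fun h i
    simp [x, hi, (hspos i).ne'] at this
  have hQ := hg.dotProduct_mulVec_pos hx
  have hQ' : star x ⬝ᵥ (g *ᵥ x) = ∑ i ∈ T, ∑ j ∈ T, g i j / (s i * s j) := by
    simp only [dotProduct, mulVec, Pi.star_apply, star_trivial, Finset.mul_sum, x, ite_mul,
      mul_ite, mul_zero, zero_mul, Finset.sum_ite_mem, Finset.univ_inter]
    simp only [Finset.sum_ite_irrel, Finset.sum_const_zero, Finset.sum_ite_mem, Finset.univ_inter]
    refine Finset.sum_congr rfl fun i _ ↦ Finset.sum_congr rfl fun j _ ↦ ?_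
    have := (hspos i).ne'
    have := (hspos j).ne'
    field_simp
  refine absurd hQ (not_lt.mpr ?_)
  rw [hQ']
  refine Finset.sum_nonpos fun i hi ↦ ?_
  -- The row of `i` has a diagonal entry `1` and two off-diagonal entries at most `-1/2`.
  obtain ⟨j, hj, hji, -, hAj⟩ := hc i hi i
  obtain ⟨k, hk, hki, hkj, hAk⟩ := hc i hi j
  have hsub : ({i, j, k} : Finset n) ⊆ T := by
    simp [Finset.insert_subset_iff, hi, hj, hk]
  rw [← Finset.sum_sdiff hsub]
  have h₁ : ∑ l ∈ T \ {i, j, k}, g i l / (s i * s l) ≤ 0 :=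
    Finset.sum_nonpos fun l hl ↦ by
      have hli : i ≠ l := fun h ↦ by simp [← h] at hl
      exact div_nonpos_of_nonpos_of_nonneg (hnonpos i l hli) (mul_pos (hspos i) (hspos l)).le
  have h₂ : ∑ l ∈ ({i, j, k} : Finset n), g i l / (s i * s l) =
      g i i / (s i * s i) + (g i j / (s i * s j) + g i k / (s i * s k)) := by
    rw [Finset.sum_insert (by simp [hji.symm, hki.symm]), Finset.sum_pair hkj.symm]
  have h₃ := hedge i j hji.symm hAj
  have h₄ := hedge i k hki.symm hAk
  rw [h₂, hsq, div_self (hpos i).ne']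
  linarith

/-- A forest is bipartite. -/
lemma exists_coloring_of_forest (hsymm : ∀ i j, A i j = 0 → A j i = 0)
    (hforest : ∀ T : Finset n, T.Nonempty → ∃ v ∈ T, ∃ u, ∀ j ∈ T, j ≠ v → j ≠ u → A v j = 0) :
    ∃ c : n → Bool, ∀ i j, i ≠ j → c i = c j → A i j = 0 := by
  suffices ∀ (k : ℕ) (T : Finset n), T.card = k →
      ∃ c : n → Bool, ∀ i ∈ T, ∀ j ∈ T, i ≠ j → c i = c j → A i j = 0 by
    obtain ⟨c, hc⟩ := this _ Finset.univ rfl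
    exact ⟨c, fun i j ↦ hc i (by simp) j (by simp)⟩
  intro k
  induction k with
  | zero => intro T hT; simp [Finset.card_eq_zero.mp hT]
  | succ k ih =>
    intro T hT
    obtain ⟨v, hv, u, hu⟩ := hforest T (Finset.card_pos.mp (by omega))
    obtain ⟨c, hc⟩ := ih (T.erase v) (by rw [Finset.card_erase_of_mem hv, hT]; rfl)
    have key (j : n) (hj : j ∈ T) (hjv : j ≠ v) (h : (!c u) = c j) : A v j = 0 :=
      hu j hj hjv fun hju ↦ by simp [hju] at h
    refine ⟨Function.update c v (!c u), fun i hi j hj hij h ↦ ?_⟩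
    by_cases hiv : i = v
    · subst hiv
      rw [Function.update_self, Function.update_of_ne hij.symm] at h
      exact key j hj hij.symm h
    · by_cases hjv : j = v
      · subst hjv
        rw [Function.update_self, Function.update_of_ne hij] at h
        exact hsymm _ _ (key i hi hij h.symm)
      · rw [Function.update_of_ne hiv, Function.update_of_ne hjv] at h
        exact hc i (by simp [hiv, hi]) j (by simp [hjv, hj]) hij h

/-- Perron–Frobenius for Cartan matrices: a connected Cartan matrix of finite type has an
eigenvector with positive coordinates, with eigenvalue in the interval `(0, 2]`. It is found by
minimizing a Rayleigh quotient, which can only decrease when coordinates are replaced by their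
absolute values. -/
lemma exists_pos_eigenvector_of_posDef [Nonempty n] (hg : g.PosDef)
    (hA : ∀ i j, 2 * g i j = A i j * g j j) (hA0 : ∀ i j, i ≠ j → A i j ≤ 0)
    (hA2 : ∀ i, A i i = 2)
    (hconn : ∀ p : n → Prop, ∀ i j, p i → (∀ i j, p i → A j i ≠ 0 → p j) → p j) :
    ∃ (r : n → ℝ) (t : ℝ), (∀ i, 0 < r i) ∧ 0 ≤ t ∧ t < 2 ∧
      ∀ i, ∑ j, (A i j : ℝ) * r j = (2 - t) * r i := by
  have hpos (i : n) : 0 < g i i := hg.diag_pos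
  have hnonpos (i j : n) (hij : i ≠ j) : g i j ≤ 0 := by
    have h₁ : (A i j : ℝ) ≤ 0 := by exact_mod_cast hA0 i j hij
    nlinarith [hA i j, hpos j]
  let Q : (n → ℝ) → ℝ := fun x ↦ x ⬝ᵥ (g *ᵥ x)
  let S : (n → ℝ) → ℝ := fun x ↦ ∑ i, g i i * x i ^ 2
  have hQ (c : ℝ) (x : n → ℝ) : Q (c • x) = c ^ 2 * Q x := by
    simp only [Q, mulVec_smul, smul_dotProduct, dotProduct_smul, smul_eq_mul]; ring
  have hS (c : ℝ) (x : n → ℝ) : S (c • x) = c ^ 2 * S x := by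
    simp only [S, Pi.smul_apply, smul_eq_mul, Finset.mul_sum]
    exact Finset.sum_congr rfl fun i _ ↦ by ring
  have hSpos (x : n → ℝ) (hx : x ≠ 0) : 0 < S x := by
    obtain ⟨i, hi⟩ := Function.ne_iff.mp hx
    exact Finset.sum_pos' (fun i _ ↦ mul_nonneg (hpos i).le (sq_nonneg _))
      ⟨i, by simp, mul_pos (hpos i) (sq_pos_of_ne_zero hi)⟩
  have hne (x : n → ℝ) (hx : x ∈ Metric.sphere (0 : n → ℝ) 1) : x ≠ 0 :=
    ne_zero_of_mem_unit_sphere (⟨x, hx⟩ : Metric.sphere (0 : n → ℝ) 1)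
  obtain ⟨x, hx, hmin⟩ := (isCompact_sphere (0 : n → ℝ) 1).exists_isMinOn
    (NormedSpace.sphere_nonempty.mpr zero_le_one) (f := fun x ↦ Q x / S x) (by
      refine ContinuousOn.div ?_ ?_ fun x hx ↦ (hSpos x (hne x hx)).ne'
      · simp only [Q, dotProduct, mulVec]; fun_prop
      · simp only [S]; fun_prop)
  set m := Q x / S x with hm
  have hx0 := hne x hx
  have hle (y : n → ℝ) : m * S y ≤ Q y := by
    by_cases hy : y = 0
    · simp [hy, S, Q]
    have hy' : 0 < ‖y‖ := norm_pos_iff.mpr hy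
    have := hmin (show ‖y‖⁻¹ • y ∈ Metric.sphere (0 : n → ℝ) 1 by
      simp [norm_smul, hy'.ne'])
    simp only [Set.mem_ofPred_eq, hQ, hS] at this
    rw [mul_div_mul_left _ _ (by positivity), ← hm, le_div_iff₀ (hSpos y hy)] at this
    exact this
  have hm0 : 0 < m := div_pos (by simpa using hg.dotProduct_mulVec_pos hx0) (hSpos x hx0)
  let r : n → ℝ := fun i ↦ |x i|
  have hQr : Q r ≤ m * S r := by
    have h₁ : S r = S x := by simp [S, r]
    have h₂ : Q r ≤ Q x := by
      simp only [Q, dotProduct, mulVec, Finset.mul_sum, r]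
      refine Finset.sum_le_sum fun i _ ↦ Finset.sum_le_sum fun j _ ↦ ?_
      by_cases hij : i = j
      · subst hij
        exact le_of_eq (by linear_combination g i i * abs_mul_abs_self (x i))
      · have := mul_le_mul_of_nonpos_left (le_abs_self (x i * x j)) (hnonpos i j hij)
        rw [abs_mul] at this
        linarith
    rw [h₁, hm, div_mul_cancel₀ _ (hSpos x hx0).ne']
    exact h₂
  -- The minimizer lies in the radical of the positive semidefinite form `Q - m S`.
  let h : Matrix n n ℝ := g - m • diagonal fun i ↦ g i i
  have hform (y : n → ℝ) : y ⬝ᵥ (h *ᵥ y) = Q y - m * S y := by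
    simp only [h, sub_mulVec, dotProduct_sub, Q, smul_mulVec, dotProduct_smul, S, smul_eq_mul]
    congr 2
    simp only [dotProduct, mulVec_diagonal]
    exact Finset.sum_congr rfl fun i _ ↦ by ring
  have hpsd : h.PosSemidef := by
    refine PosSemidef.of_dotProduct_mulVec_nonneg ?_ fun y ↦ ?_
    · refine hg.isHermitian.sub ?_
      rw [IsHermitian, conjTranspose_smul, diagonal_conjTranspose]
      simp
    · rw [star_trivial, hform]
      linarith [hle y]
  have hker : h *ᵥ r = 0 := by
    rw [← hpsd.dotProduct_mulVec_zero_iff, star_trivial, hform]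
    linarith [hle r]
  have heig (i : n) : ∑ j, g i j * r j = m * (g i i * r i) := by
    have := congr_fun hker i
    simp only [h, sub_mulVec, smul_mulVec, Pi.sub_apply, Pi.smul_apply, mulVec_diagonal,
      smul_eq_mul, Pi.zero_apply, sub_eq_zero] at this
    exact this
  have hr0 (i : n) : 0 ≤ r i := abs_nonneg _
  have hAr (i : n) : ∑ j, (A i j : ℝ) * (g j j * r j) = 2 * m * (g i i * r i) := by
    rw [mul_assoc, ← heig, Finset.mul_sum]
    exact Finset.sum_congr rfl fun j _ ↦ by linear_combination -r j * hA i j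
  have hoff (i j : n) (hij : j ∈ Finset.univ.erase i) : (A i j : ℝ) * (g j j * r j) ≤ 0 := by
    have h₁ : (A i j : ℝ) ≤ 0 := by exact_mod_cast hA0 i j (Finset.ne_of_mem_erase hij).symm
    exact mul_nonpos_of_nonpos_of_nonneg h₁ (mul_nonneg (hpos j).le (hr0 j))
  have hsplit (i : n) : 2 * (g i i * r i) +
      ∑ j ∈ Finset.univ.erase i, (A i j : ℝ) * (g j j * r j) = 2 * m * (g i i * r i) := by
    rw [← hAr, ← Finset.add_sum_erase _ _ (Finset.mem_univ i), hA2]; norm_num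
  have hsymm (i j : n) (hij : A i j = 0) : A j i = 0 := by
    have h₁ : g i j = 0 := by have := hA i j; rw [hij] at this; simpa using this
    have h₂ := hA j i
    rw [show g j i = g i j by simpa using (hg.isHermitian.apply i j), h₁] at h₂
    simpa [(hpos i).ne'] using h₂.symm
  have hrpos (i : n) : 0 < r i := by
    refine lt_of_le_of_ne (hr0 i) fun hi ↦ hx0 ?_
    ext j
    suffices r j = 0 by simpa [r] using this
    refine hconn (fun j ↦ r j = 0) i j hi.symm fun k l hk hlk ↦ ?_
    have h₁ := hsplit k
    simp only [hk, mul_zero, zero_add] at h₁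
    rcases eq_or_ne k l with rfl | hkl; · exact hk
    have h₂ := (Finset.sum_eq_zero_iff_of_nonpos (hoff k)).mp h₁ l (by simp [hkl.symm])
    have : A k l ≠ 0 := fun h ↦ hlk (hsymm _ _ h)
    simpa [this, (hpos l).ne'] using h₂
  refine ⟨fun i ↦ g i i * r i, 2 - 2 * m, fun i ↦ mul_pos (hpos i) (hrpos i), ?_, by linarith,
    fun i ↦ by rw [hAr]; ring⟩
  obtain ⟨i⟩ := ‹Nonempty n›
  have h₁ := hsplit i
  have h₂ := Finset.sum_nonpos (hoff i)
  have h₃ := mul_pos (hpos i) (hrpos i)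
  nlinarith

end Matrix

/-! ### The number of roots and the Coxeter number -/

/-- If `T` meets each orbit of a permutation `w`, and no nontrivial power of `w` maps an element of
`T` into `T`, then all orbits have `orderOf w` elements, exactly one of them in `T`. -/
lemma Equiv.Perm.card_eq_orderOf_mul_card {ι : Type*} [Finite ι] (w : Equiv.Perm ι) (T : Set ι)
    (h₁ : ∀ i, ∃ k : ℕ, (w ^ k) i ∈ T) (h₂ : ∀ i ∈ T, ∀ k : ℤ, (w ^ k) i ∈ T → w ^ k = 1) :
    Nat.card ι = orderOf w * Nat.card T := by
  have hw : 0 < orderOf w := orderOf_pos w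
  have hzpow {k l : Fin (orderOf w)} (h : w ^ ((k : ℤ) - l) = 1) : k = l := by
    have hkl : w ^ (k : ℕ) = w ^ (l : ℕ) := by
      rw [zpow_sub, mul_inv_eq_one] at h
      exact_mod_cast h
    exact Fin.ext (pow_injOn_Iio_orderOf (by simp) (by simp) hkl)
  let F : Fin (orderOf w) × T → ι := fun x ↦ (w ^ (x.1 : ℕ)) x.2
  have hF : Function.Bijective F := by
    refine ⟨fun ⟨k, i, hi⟩ ⟨l, j, hj⟩ h ↦ ?_, fun i ↦ ?_⟩
    · have h' : (w ^ ((k : ℤ) - l)) i = j := by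
        rw [sub_eq_neg_add, zpow_add, Equiv.Perm.mul_apply, zpow_natCast,
          show (w ^ (k : ℕ)) i = (w ^ (l : ℕ)) j from h, zpow_neg, zpow_natCast,
          Equiv.Perm.inv_eq_iff_eq]
      have h1 := h₂ i hi _ (h' ▸ hj)
      obtain rfl := hzpow h1
      rw [h1] at h'
      simpa using h'
    · obtain ⟨k, hk⟩ := h₁ i
      have hk' : ((w ^ (-(k : ℤ))) ((w ^ k) i)) = i := by simp
      rw [← zpow_mod_orderOf] at hk'
      have h0 := Int.emod_nonneg (-(k : ℤ)) (b := (orderOf w : ℤ)) (by omega)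
      have hlt := Int.emod_lt_of_pos (-(k : ℤ)) (b := (orderOf w : ℤ)) (by omega)
      refine ⟨⟨⟨(-(k : ℤ) % (orderOf w : ℤ)).toNat, by omega⟩, ⟨_, hk⟩⟩, ?_⟩
      simp only [F]
      rw [← zpow_natCast, Int.toNat_of_nonneg h0]
      exact hk'
  rw [← Nat.card_eq_of_bijective F hF, Nat.card_prod, Nat.card_fin]

namespace RootPairing

/-- The product of the reflections in pairwise orthogonal roots, in closed form. -/
lemma prod_reflection_apply {ι R M N : Type*} [CommRing R] [AddCommGroup M] [Module R M]
    [AddCommGroup N] [Module R N] (P : RootPairing ι R M N) {l : List ι} (hl : l.Nodup)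
    (horth : ∀ i ∈ l, ∀ j ∈ l, i ≠ j → P.pairing i j = 0) (x : M) :
    (l.map P.reflection).prod x = x - (l.map fun j ↦ P.coroot' j x • P.root j).sum := by
  induction l with
  | nil => simp
  | cons j l ih =>
    rw [List.nodup_cons] at hl
    have h0 : P.coroot' j (l.map fun j ↦ P.coroot' j x • P.root j).sum = 0 := by
      rw [map_list_sum, List.map_map]
      refine List.sum_eq_zero fun y hy ↦ ?_
      obtain ⟨k, hk, rfl⟩ := List.mem_map.mp hy
      simp [horth k (by simp [hk]) j (by simp) fun h ↦ hl.1 (h ▸ hk)]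
    rw [List.map_cons, List.prod_cons, LinearEquiv.mul_apply,
      ih hl.2 fun i hi k hk ↦ horth i (by simp [hi]) k (by simp [hk]), reflection_apply, map_sub,
      h0, List.map_cons, List.sum_cons]
    rw [sub_zero]
    abel

namespace Base

section

variable {ι R M N : Type*} [CommRing R] [CharZero R] [IsDomain R] [Finite ι] [AddCommGroup M]
  [Module R M] [AddCommGroup N] [Module R N] {P : RootPairing ι R M N} [P.IsCrystallographic]
  {b : P.Base}

/-- An additive functional that is positive on the simple roots is positive on all positive roots.
-/
lemma IsPos.apply_root_pos {i : ι} (hi : b.IsPos i) (f : M →+ ℝ)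
    (hf : ∀ j ∈ b.support, 0 < f (P.root j)) : 0 < f (P.root i) := by
  refine hi.induction_on_add hf fun i j k hk h hj ↦ ?_
  rw [hk, map_add]
  exact add_pos h (hf j hj)

lemma apply_root_neg_of_not_isPos {i : ι} (hi : ¬ b.IsPos i) (f : M →+ ℝ)
    (hf : ∀ j ∈ b.support, 0 < f (P.root j)) : f (P.root i) < 0 := by
  have := ((b.isPos_reflectionPerm_self_iff i).mpr hi).apply_root_pos f hf
  rw [root_reflectionPerm, reflection_apply_self, map_neg] at this
  linarith

/-- An element of the Weyl group which maps positive roots to positive roots is the identity. -/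
lemma eq_one_of_mem_closure [P.IsReduced] {u : Equiv.Perm ι}
    (hu : u ∈ Subgroup.closure (P.reflectionPerm '' b.support))
    (hpos : ∀ i, b.IsPos i → b.IsPos (u i)) : u = 1 := by
  obtain ⟨l, hl, rfl⟩ : ∃ l : List ι, (∀ j ∈ l, j ∈ b.support) ∧
      (l.map P.reflectionPerm).prod = u := by
    clear hpos
    induction hu using Subgroup.closure_induction with
    | mem x hx => obtain ⟨j, hj, rfl⟩ := hx; exact ⟨[j], by simpa using hj, by simp⟩
    | one => exact ⟨[], by simp, by simp⟩
    | mul x y _ _ hx hy =>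
      obtain ⟨l, hl, rfl⟩ := hx
      obtain ⟨l', hl', rfl⟩ := hy
      refine ⟨l ++ l', fun j hj ↦ ?_, by simp⟩
      exact (List.mem_append.mp hj).elim (hl j) (hl' j)
    | inv x _ hx =>
      obtain ⟨l, hl, rfl⟩ := hx
      exact ⟨l.reverse, by simpa using hl, (P.inv_prod_reflectionPerm l).symm⟩
  exact prod_reflectionPerm_eq_one _ le_rfl hl hpos

end

variable {ι M N : Type*} [AddCommGroup M] [Module ℂ M] [AddCommGroup N] [Module ℂ N]
  {P : RootPairing ι ℂ M N} (b : P.Base)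

/-- The list of simple roots of a given colour. -/
noncomputable def colorList (c : b.support → Bool) (e : Bool) : List ι :=
  (Finset.univ.filter fun i ↦ c i = e).toList.map Subtype.val

variable {b}

lemma mem_colorList {c : b.support → Bool} {e : Bool} {i : ι} :
    i ∈ b.colorList c e ↔ ∃ h : i ∈ b.support, c ⟨i, h⟩ = e := by
  simp [colorList]

lemma nodup_colorList (c : b.support → Bool) (e : Bool) : (b.colorList c e).Nodup :=
  (Finset.nodup_toList _).map Subtype.val_injective

variable (b) in
/-- The functional whose value on the simple root `i` of colour `c i` is `p (c i) * r i`. For fixed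
`c` and `r` these functionals form a plane, which is the Coxeter plane when `r` is an eigenvector of
the Cartan matrix and `c` a proper colouring of the Dynkin diagram. -/
noncomputable def colorDual [P.IsRootSystem] (c : b.support → Bool) (r : b.support → ℝ)
    (p : Bool → ℂ) : M →ₗ[ℂ] ℂ :=
  b.toWeightBasis.constr ℂ fun i ↦ p (c i) * r i

lemma colorDual_root [P.IsRootSystem] (c : b.support → Bool) (r : b.support → ℝ) (p : Bool → ℂ)
    (i : b.support) :
    b.colorDual c r p (P.root i) = p (c i) * r i := by
  rw [colorDual, ← b.toWeightBasis_apply, Module.Basis.constr_basis]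

lemma colorDual_mul [P.IsRootSystem] (c : b.support → Bool) (r : b.support → ℝ) (p : Bool → ℂ)
    (a : ℂ) (x : M) :
    b.colorDual c r (fun e ↦ a * p e) x = a * b.colorDual c r p x := by
  suffices b.colorDual c r (fun e ↦ a * p e) = a • b.colorDual c r p from LinearMap.congr_fun this x
  refine b.toWeightBasis.ext fun i ↦ ?_
  rw [LinearMap.smul_apply, b.toWeightBasis_apply, colorDual_root, colorDual_root, smul_eq_mul,
    mul_assoc]

/-- The product of the reflections in the simple roots of one colour maps the plane of functionals
`colorDual` to itself, acting there as a reflection. -/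
lemma colorDual_prod_reflection [P.IsCrystallographic] [P.IsRootSystem]
    {c : b.support → Bool} {r : b.support → ℝ} {t : ℝ}
    (hc : ∀ i j, i ≠ j → c i = c j → b.cartanMatrix i j = 0)
    (hr : ∀ i, ∑ j, (b.cartanMatrix i j : ℝ) * r j = (2 - t) * r i)
    (p : Bool → ℂ) (e : Bool) (x : M) :
    b.colorDual c r p (((b.colorList c e).map P.reflection).prod x) =
      b.colorDual c r (fun d ↦ if d = e then - p e else p (!e) + t * p e) x := by
  suffices b.colorDual c r p ∘ₗ ((b.colorList c e).map P.reflection).prod.toLinearMap =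
      b.colorDual c r (fun d ↦ if d = e then - p e else p (!e) + t * p e) from
    LinearMap.congr_fun this x
  refine b.toWeightBasis.ext fun i ↦ ?_
  have hpair (i j : b.support) : P.pairing i j = b.cartanMatrix i j :=
    (b.algebraMap_cartanMatrixIn_apply ℤ i j).symm
  have horth : ∀ i ∈ b.colorList c e, ∀ j ∈ b.colorList c e, i ≠ j → P.pairing i j = 0 := by
    intro i hi j hj hij
    obtain ⟨hi, hi'⟩ := mem_colorList.mp hi
    obtain ⟨hj, hj'⟩ := mem_colorList.mp hj
    have := hc ⟨i, hi⟩ ⟨j, hj⟩ (by simpa using hij) (hi'.trans hj'.symm)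
    have h₂ := hpair ⟨i, hi⟩ ⟨j, hj⟩
    rw [this] at h₂
    simpa using h₂
  rw [LinearMap.comp_apply, LinearEquiv.coe_coe, b.toWeightBasis_apply,
    P.prod_reflection_apply (nodup_colorList c e) horth, map_sub, colorDual_root, colorDual_root,
    colorList, List.map_map, Finset.sum_map_toList, map_sum]
  have hsum : ∑ j with c j = e, (b.cartanMatrix i j : ℝ) * r j =
      if c i = e then 2 * r i else - t * r i := by
    split_ifs with hi
    · rw [Finset.sum_eq_single i (fun j hj hji ↦ ?_) (by simp [hi])]
      · simp
      · rw [hc i j hji.symm (by rw [hi, (Finset.mem_filter.mp hj).2])]; simp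
    · have h₁ : ∑ j with ¬ c j = e, (b.cartanMatrix i j : ℝ) * r j = 2 * r i := by
        rw [Finset.sum_eq_single i (fun j hj hji ↦ ?_) (by simp [hi])]
        · simp
        · have hj' := (Finset.mem_filter.mp hj).2
          rw [hc i j hji.symm (by
            rw [Bool.eq_not_of_ne hi, Bool.eq_not_of_ne hj'])]
          simp
      have h₂ := Finset.sum_filter_add_sum_filter_not Finset.univ (fun j ↦ c j = e)
        fun j ↦ (b.cartanMatrix i j : ℝ) * r j
      rw [h₁, hr] at h₂
      linarith
  have hsum' : ∑ j with c j = e, b.colorDual c r p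
      (((fun j ↦ P.coroot' j (P.root i) • P.root j) ∘ Subtype.val) j) =
      p e * ((∑ j with c j = e, (b.cartanMatrix i j : ℝ) * r j : ℝ) : ℂ) := by
    push_cast
    rw [Finset.mul_sum]
    refine Finset.sum_congr rfl fun j hj ↦ ?_
    rw [Function.comp_apply, map_smul, colorDual_root, root_coroot'_eq_pairing, hpair,
      (Finset.mem_filter.mp hj).2, smul_eq_mul]
    ring
  rw [hsum', hsum]
  by_cases hi : c i = e
  · rw [if_pos hi, if_pos hi, hi]
    push_cast
    ring
  · rw [if_neg hi, if_neg hi, Bool.eq_not_of_ne hi]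
    push_cast
    ring

end Base

end RootPairing

namespace RootPairing.Base

variable {ι M N : Type*} [Finite ι] [AddCommGroup M] [Module ℂ M] [AddCommGroup N] [Module ℂ N]
  {P : RootPairing ι ℂ M N} [P.IsCrystallographic] [P.IsRootSystem] [P.IsReduced] {b : P.Base}

/-- The number of roots is the rank times the order of a bipartite Coxeter element `w`.

The set `T` of positive roots made negative by `w` has as many elements as there are simple roots.
A functional `φ` with `φ ∘ w = η ^ 4 • φ`, such that the sign of a root is the sign of the imaginary
part of `η * φ`, shows that `T` meets every `w`-orbit, and that a power of `w` mapping an element of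
`T` into `T` is trivial. -/
lemma card_eq_orderOf_mul_card_of_bipartite {c : b.support → Bool}
    {r : b.support → ℝ} {t : ℝ}
    (hc : ∀ i j, i ≠ j → c i = c j → b.cartanMatrix i j = 0) (hr0 : ∀ i, 0 < r i)
    (ht0 : 0 ≤ t) (ht2 : t < 2)
    (hr : ∀ i, ∑ j, (b.cartanMatrix i j : ℝ) * r j = (2 - t) * r i) :
    Nat.card ι = orderOf (((b.colorList c true).map P.reflectionPerm).prod *
      ((b.colorList c false).map P.reflectionPerm).prod) * b.support.card := by
  classical
  have hpair (i j : b.support) : P.pairing i j = b.cartanMatrix i j :=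
    (b.algebraMap_cartanMatrixIn_apply ℤ i j).symm
  have horth (e : Bool) : ∀ i ∈ b.colorList c e, ∀ j ∈ b.colorList c e, i ≠ j →
      P.pairing i j = 0 := by
    intro i hi j hj hij
    obtain ⟨hi, hi'⟩ := mem_colorList.mp hi
    obtain ⟨hj, hj'⟩ := mem_colorList.mp hj
    have := hc ⟨i, hi⟩ ⟨j, hj⟩ (by simpa using hij) (hi'.trans hj'.symm)
    have h₂ := hpair ⟨i, hi⟩ ⟨j, hj⟩
    rw [this] at h₂
    simpa using h₂
  have hsupp (e : Bool) : ∀ j ∈ b.colorList c e, j ∈ b.support := fun j hj ↦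
    (mem_colorList.mp hj).1
  set y := ((b.colorList c true).map P.reflectionPerm).prod with hy
  set z := ((b.colorList c false).map P.reflectionPerm).prod with hz
  set w := y * z with hw
  have hzneg (i : ι) (hi : i ∈ b.colorList c false) : z i = P.reflectionPerm i i :=
    P.prod_reflectionPerm_of_mem (nodup_colorList c false) (horth false) hi
  have hypos (i : ι) (hi : b.IsPos i) (hi' : i ∉ b.colorList c true) : b.IsPos (y i) :=
    hi.prod_reflectionPerm (hsupp true) (nodup_colorList c true) (horth true) hi'
  have hzpos (i : ι) (hi : b.IsPos i) (hi' : i ∉ b.colorList c false) : b.IsPos (z i) :=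
    hi.prod_reflectionPerm (hsupp false) (nodup_colorList c false) (horth false) hi'
  -- The positive roots made negative by `w`.
  let F : b.support → ι := fun i ↦ if c i = true then z⁻¹ i else i
  have hmem (i : b.support) (e : Bool) (h : c i = e) : (i : ι) ∈ b.colorList c e :=
    mem_colorList.mpr ⟨i.2, h⟩
  have hzF {i : b.support} (hi : c i = false) : ¬ b.IsPos (z i) := by
    rw [hzneg _ (hmem i _ hi), isPos_reflectionPerm_self_iff, not_not]
    exact isPos_of_mem_support i.2
  have hF : Function.Injective F := by
    intro i j hij
    simp only [F] at hij
    split_ifs at hij with h₁ h₂ h₂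
    · exact Subtype.ext (z⁻¹.injective hij)
    · exfalso
      rw [Equiv.Perm.inv_eq_iff_eq] at hij
      exact hzF (by simpa using h₂) (hij ▸ isPos_of_mem_support i.2)
    · exfalso
      rw [eq_comm, Equiv.Perm.inv_eq_iff_eq] at hij
      exact hzF (by simpa using h₁) (hij ▸ isPos_of_mem_support j.2)
    · exact Subtype.ext hij
  have hT (i : ι) (hi : b.IsPos i) (hwi : ¬ b.IsPos (w i)) : i ∈ Set.range F := by
    by_cases hi' : i ∈ b.colorList c false
    · obtain ⟨h, h'⟩ := mem_colorList.mp hi'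
      exact ⟨⟨i, h⟩, by simp [F, h']⟩
    · have hzi : z i ∈ b.colorList c true := by
        by_contra h
        exact hwi (hypos _ (hzpos i hi hi') h)
      obtain ⟨h, h'⟩ := mem_colorList.mp hzi
      exact ⟨⟨z i, h⟩, by simp [F, h']⟩
  -- The eigenvector of `w` in the Coxeter plane: with `t = 2 cos θ` take `η = exp (i θ / 2)`. The
  -- values `1` and `-η⁻²` of `φ / r` on the two colours become `η` and `-η⁻¹` in `φ * η`, which
  -- have the same positive imaginary part.
  obtain ⟨η, hη0, hre, him, hconj, htη⟩ : ∃ η : ℂ, η ≠ 0 ∧ 0 < η.re ∧ 0 < η.im ∧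
      (starRingEnd ℂ) η = η⁻¹ ∧ (t : ℂ) = η ^ 2 + (η ^ 2)⁻¹ := by
    have ha : 0 < √((2 + t) / 4) := Real.sqrt_pos.mpr (by linarith)
    have hd : 0 < √((2 - t) / 4) := Real.sqrt_pos.mpr (by linarith)
    have ha2 := Real.sq_sqrt (show 0 ≤ (2 + t) / 4 by linarith)
    have hd2 := Real.sq_sqrt (show 0 ≤ (2 - t) / 4 by linarith)
    set a := √((2 + t) / 4)
    set d := √((2 - t) / 4)
    have hinv : (⟨a, -d⟩ : ℂ) = (⟨a, d⟩ : ℂ)⁻¹ := by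
      refine eq_inv_of_mul_eq_one_left (Complex.ext ?_ ?_)
      · simp only [Complex.mul_re, Complex.one_re]; linarith
      · simp only [Complex.mul_im, Complex.one_im]; ring
    refine ⟨⟨a, d⟩, fun h ↦ ha.ne' (congr_arg Complex.re h), ha, hd, ?_, ?_⟩
    · rw [← hinv]; rfl
    · rw [← inv_pow, ← hinv]
      refine Complex.ext ?_ ?_
      · simp only [sq, Complex.add_re, Complex.mul_re, Complex.ofReal_re]; linarith
      · simp only [sq, Complex.add_im, Complex.mul_im, Complex.ofReal_im]; ring
  have hnorm : ‖η‖ = 1 := by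
    have h := Complex.mul_conj η
    rw [hconj, mul_inv_cancel₀ hη0, Complex.normSq_eq_norm_sq] at h
    have h' : ‖η‖ ^ 2 = 1 := by exact_mod_cast h.symm
    exact (pow_eq_one_iff_of_nonneg (norm_nonneg _) two_ne_zero).mp h'
  have hinvim : (η⁻¹).im = - η.im := by rw [← hconj]; simp
  let p : Bool → ℂ := fun e ↦ if e = true then 1 else -(η ^ 2)⁻¹
  let φ : M →ₗ[ℂ] ℂ := b.colorDual c r p
  have hφz (i : ι) : b.colorDual c r (fun e ↦ if e = true then -(η ^ 4)⁻¹ else (η ^ 2)⁻¹)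
      (P.root (z i)) = φ (P.root i) := by
    rw [hz, root_prod_reflectionPerm, colorDual_prod_reflection hc hr]
    congr 2
    ext e
    cases e
    · simp [p]
    · simp [p, htη]; field_simp; ring
  have hφw (i : ι) : φ (P.root (w i)) = η ^ 4 * φ (P.root i) := by
    rw [hw, Equiv.Perm.mul_apply, hy, root_prod_reflectionPerm, colorDual_prod_reflection hc hr, hz,
      root_prod_reflectionPerm, colorDual_prod_reflection hc hr, ← colorDual_mul]
    congr 2
    ext e
    cases e
    · simp [p, htη]; field_simp
    · simp [p, htη]; field_simp; ring
  have hφpow (k : ℕ) (i : ι) : φ (P.root ((w ^ k) i)) = (η ^ 4) ^ k * φ (P.root i) := by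
    induction k with
    | zero => simp
    | succ k ih => rw [pow_succ', Equiv.Perm.mul_apply, hφw, ih, pow_succ' (η ^ 4), mul_assoc]
  have hφzpow (k : ℤ) (i : ι) : φ (P.root ((w ^ k) i)) = (η ^ 4) ^ k * φ (P.root i) := by
    obtain ⟨k, rfl | rfl⟩ := k.eq_nat_or_neg
    · exact_mod_cast hφpow k i
    · have := hφpow k ((w ^ (-(k : ℤ))) i)
      rw [← Equiv.Perm.mul_apply, zpow_neg, zpow_natCast, mul_inv_cancel,
        Equiv.Perm.one_apply] at this
      rw [zpow_neg, zpow_neg, this, zpow_natCast, zpow_natCast,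
        inv_mul_cancel_left₀ (pow_ne_zero _ (pow_ne_zero _ hη0))]
  have hφsimple (j : b.support) : φ (P.root j) = p (c j) * r j := colorDual_root c r p j
  have hφF (j : b.support) : φ (P.root (F j)) =
      (if c j = true then -(η ^ 4)⁻¹ else -(η ^ 2)⁻¹) * r j := by
    by_cases hj : c j = true
    · rw [show F j = z⁻¹ j from if_pos hj, ← hφz, ← Equiv.Perm.mul_apply, mul_inv_cancel,
        Equiv.Perm.one_apply, colorDual_root, hj]
      simp
    · rw [show F j = j from if_neg hj, hφsimple, if_neg hj]
      simp [p, hj]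
  let ψ : M →+ ℝ := Complex.imAddGroupHom.comp ((AddMonoidHom.mulRight η).comp φ.toAddMonoidHom)
  have hψ (x : M) : ψ x = (φ x * η).im := rfl
  have hψsimple (j : ι) (hj : j ∈ b.support) : 0 < ψ (P.root j) := by
    rw [hψ, show φ (P.root j) = _ from hφsimple ⟨j, hj⟩]
    suffices (p (c ⟨j, hj⟩) * r ⟨j, hj⟩ * η).im = r ⟨j, hj⟩ * η.im by
      rw [this]; exact mul_pos (hr0 _) him
    cases c ⟨j, hj⟩
    · rw [show p false * r ⟨j, hj⟩ * η = (-r ⟨j, hj⟩ : ℝ) * η⁻¹ by simp [p]; field_simp,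
        Complex.im_ofReal_mul, hinvim]
      ring
    · simp [p]
  have hpos {i : ι} (hi : b.IsPos i) : 0 < ψ (P.root i) := hi.apply_root_pos ψ hψsimple
  have hneg {i : ι} (hi : ¬ b.IsPos i) : ψ (P.root i) < 0 :=
    apply_root_neg_of_not_isPos hi ψ hψsimple
  have hψ0 (i : ι) : ψ (P.root i) ≠ 0 := by
    by_cases hi : b.IsPos i
    · exact (hpos hi).ne'
    · exact (hneg hi).ne
  have hφ0 (i : ι) : φ (P.root i) ≠ 0 := fun h ↦ hψ0 i (by rw [hψ, h]; simp)
  -- A power of `w` that fixes `φ` preserves positivity, hence is trivial.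
  have hfree (k : ℤ) (hk : (η ^ 4) ^ k = 1) : w ^ k = 1 := by
    refine eq_one_of_mem_closure (b := b) (Subgroup.zpow_mem _ (mul_mem ?_ ?_) k) fun i hi ↦ ?_
    · exact Subgroup.list_prod_mem _ fun x hx ↦ by
        obtain ⟨j, hj, rfl⟩ := List.mem_map.mp hx
        exact Subgroup.subset_closure ⟨j, hsupp _ j hj, rfl⟩
    · exact Subgroup.list_prod_mem _ fun x hx ↦ by
        obtain ⟨j, hj, rfl⟩ := List.mem_map.mp hx
        exact Subgroup.subset_closure ⟨j, hsupp _ j hj, rfl⟩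
    · by_contra h
      have h₁ := hneg h
      rw [hψ, hφzpow, hk, one_mul] at h₁
      exact absurd h₁ (hpos hi).not_gt
  rw [Equiv.Perm.card_eq_orderOf_mul_card w (Set.range F) ?_ ?_,
    Nat.card_range_of_injective hF, Nat.card_eq_fintype_card, Fintype.card_coe]
  -- The `w`-orbit of a root contains roots of both signs, as the values of `φ` on it sum to zero.
  · intro i
    by_contra! hcon
    have hstep (k : ℕ) (hk : b.IsPos ((w ^ k) i)) : b.IsPos ((w ^ (k + 1)) i) := by
      by_contra h
      exact hcon k (hT _ hk (by rwa [pow_succ', Equiv.Perm.mul_apply] at h))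
    have hη1 : η ^ 4 ≠ 1 := fun h ↦ by
      have h' : (η ^ 2 - 1) * (η ^ 2 + 1) = 0 := by linear_combination h
      rcases mul_eq_zero.mp h' with h | h
      · have := congr_arg Complex.im h
        simp [sq] at this
        nlinarith
      · have := congr_arg Complex.im h
        simp [sq] at this
        nlinarith
    have hord : (η ^ 4) ^ orderOf w = 1 := by
      have := hφzpow (orderOf w) i
      rw [zpow_natCast, pow_orderOf_eq_one, zpow_natCast] at this
      exact (mul_eq_right₀ (hφ0 i)).mp this.symm
    have hsum (m : ℕ) : ∑ k ∈ Finset.range (orderOf w), ψ (P.root ((w ^ (m + k)) i)) = 0 := by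
      have h₁ : ∑ k ∈ Finset.range (orderOf w), φ (P.root ((w ^ (m + k)) i)) = 0 := by
        have h₂ (k : ℕ) : φ (P.root ((w ^ (m + k)) i)) =
            (η ^ 4) ^ k * ((η ^ 4) ^ m * φ (P.root i)) := by
          rw [← zpow_natCast, hφzpow, zpow_natCast, pow_add]; ring
        simp_rw [h₂]
        rw [← Finset.sum_mul, geom_sum_eq hη1, hord]
        simp
      rw [← map_sum, hψ, map_sum, h₁]
      simp
    have hne : (Finset.range (orderOf w)).Nonempty := by
      simpa using (orderOf_pos w).ne'
    by_cases hex : ∃ m, b.IsPos ((w ^ m) i)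
    · obtain ⟨m, hm⟩ := hex
      have hall (k : ℕ) : b.IsPos ((w ^ (m + k)) i) := by
        induction k with
        | zero => exact hm
        | succ k ih => exact hstep _ ih
      exact (Finset.sum_pos (fun k _ ↦ hpos (hall k)) hne).ne' (hsum m)
    · push Not at hex
      exact (Finset.sum_neg (fun k _ ↦ hneg (hex (0 + k))) hne).ne (hsum 0)
  -- Suppose `F j = w ^ k (F i)`. If `i` and `j` had different colours, then an odd power of `η`
  -- would be `1` or `-1`, and `η * φ` would be real on some root.
  · rintro - ⟨i, rfl⟩ k ⟨j, hj⟩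
    have hk := hφzpow k (F i)
    rw [← hj, hφF, hφF] at hk
    have hratio {x : ℂ} (hx : ‖x‖ = 1) (h : (r j : ℂ) = x * r i) : x = 1 := by
      have hx' : r j = r i := by
        have := congr_arg norm h
        rw [norm_mul, hx, one_mul, Complex.norm_real, Complex.norm_real,
          Real.norm_of_nonneg (hr0 j).le, Real.norm_of_nonneg (hr0 i).le] at this
        exact this
      rw [hx'] at h
      have h0 : (r i : ℂ) ≠ 0 := by exact_mod_cast (hr0 i).ne'
      exact (mul_eq_right₀ h0).mp h.symm
    have hodd (m : ℤ) (l : b.support) (hl : η ^ (4 * m + if c l = true then 1 else -1) = 1 ∨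
        η ^ (4 * m + if c l = true then 1 else -1) = -1) : False := by
      apply hψ0 ((w ^ m) l)
      rw [hψ, hφzpow, hφsimple]
      suffices ((η ^ 4) ^ m * (p (c l) * r l) * η) =
          (if c l = true then r l else -r l : ℝ) * η ^ (4 * m + if c l = true then 1 else -1) by
        rw [this, Complex.im_ofReal_mul]
        rcases hl with hl | hl <;> simp [hl]
      rw [← zpow_natCast η 4, ← zpow_mul, zpow_add₀ hη0]
      cases c l
      · simp [p]; field_simp
      · simp [p]; ring
    have hmixed (m : ℤ) (l l' : b.support) (hl : c l = true) (hl' : ¬ c l' = true)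
        (h : η ^ (4 * m + 2) = 1) : False := by
      have h₁ : (η ^ (2 * m + 1)) ^ 2 = 1 := by
        rw [← zpow_natCast, ← zpow_mul, ← h]; congr 1; push_cast; ring
      rw [sq, mul_self_eq_one_iff] at h₁
      rcases Int.even_or_odd' m with ⟨n, rfl | rfl⟩
      · refine hodd n l ?_
        rw [if_pos hl]
        convert h₁ using 3 <;> ring
      · refine hodd (n + 1) l' ?_
        rw [if_neg hl']
        convert h₁ using 3 <;> ring
    have hunit (n : ℤ) : ‖η ^ n‖ = 1 := by rw [norm_zpow, hnorm, one_zpow]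
    have h4 (n : ℤ) : (η ^ 4) ^ n = η ^ (4 * n) := by
      rw [← zpow_natCast η 4, ← zpow_mul]; rfl
    rw [h4] at hk
    by_cases hi : c i = true <;> by_cases hj : c j = true
    · rw [if_pos hi, if_pos hj] at hk
      refine hfree k ?_
      rw [h4]
      refine hratio (hunit _) ?_
      field_simp at hk
      linear_combination -hk
    · rw [if_pos hi, if_neg hj] at hk
      refine (hmixed (k - 1) i j hi hj (hratio (hunit _) ?_)).elim
      rw [show 4 * (k - 1) + 2 = 4 * k - 2 by ring, zpow_sub₀ hη0]
      field_simp at hk ⊢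
      linear_combination -hk
    · rw [if_neg hi, if_pos hj] at hk
      refine (hmixed k j i hj hi (hratio (hunit _) ?_)).elim
      rw [zpow_add₀ hη0]
      field_simp at hk ⊢
      linear_combination -hk
    · rw [if_neg hi, if_neg hj] at hk
      refine hfree k ?_
      rw [h4]
      refine hratio (hunit _) ?_
      field_simp at hk
      linear_combination -hk

end RootPairing.Base

/-- A finite irreducible root system has `n h` roots, where `n` is its rank and `h` the order of any
Coxeter element. The Dynkin diagram is a forest, so it is bipartite and the given Coxeter element is
conjugate to a bipartite one. -/
theorem RootPairing.IsCoxeterElement.card_eq_orderOf_mul_finrank {ι M N : Type*} [Finite ι]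
    [AddCommGroup M] [Module ℂ M] [AddCommGroup N] [Module ℂ N] {P : RootPairing ι ℂ M N}
    [P.IsCrystallographic] [P.IsRootSystem] [P.IsReduced] [P.IsIrreducible] {w : M ≃ₗ[ℂ] M}
    (hw : P.IsCoxeterElement w) :
    Nat.card ι = orderOf w * Module.finrank ℂ M := by
  classical
  obtain ⟨b, l, hl, hlb, rfl⟩ := hw
  have : Nonempty ι := by
    have : Nontrivial M := IsIrreducible.nontrivial P
    by_contra h
    rw [not_nonempty_iff] at h
    have := IsRootSystem.span_root_eq_top (P := P)
    simp [Set.range_eq_empty] at this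
  have : Nonempty b.support := b.support_nonempty.to_subtype
  obtain ⟨g, hg, hA⟩ := b.exists_gram
  have hA0 : ∀ i j, i ≠ j → b.cartanMatrix i j ≤ 0 := b.cartanMatrix_le_zero_of_ne
  have hforest := Matrix.exists_leaf_of_posDef hg hA hA0
  have hsymm (i j : b.support) (h : b.cartanMatrix i j = 0) : b.cartanMatrix j i = 0 :=
    b.cartanMatrix_apply_eq_zero_iff_symm.mp h
  obtain ⟨c, hc⟩ := Matrix.exists_coloring_of_forest hsymm hforest
  obtain ⟨r, t, hr0, ht0, ht2, hr⟩ := Matrix.exists_pos_eigenvector_of_posDef hg hA hA0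
    (fun i ↦ b.cartanMatrix_apply_same i) fun p i j hi hp ↦ b.induction_on_cartanMatrix p hi hp
  have hcard := Base.card_eq_orderOf_mul_card_of_bipartite hc hr0 ht0 ht2 hr
  have hpair (i j : b.support) : P.pairing i j = b.cartanMatrix i j :=
    (b.algebraMap_cartanMatrixIn_apply ℤ i j).symm
  have hconj : IsConj ((b.colorList c true ++ b.colorList c false).map P.reflectionPerm).prod
      (l.map P.reflectionPerm).prod := by
    refine isConj_prod_of_forest (fun i j ↦ P.pairing i j ≠ 0) b.support ?_ _ ?_ ?_ hl ?_ hlb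
    · intro T hT hT'
      obtain ⟨v, hv, u, hu⟩ := hforest (T.subtype (· ∈ b.support)) (by
        obtain ⟨i, hi⟩ := hT'
        exact ⟨⟨i, hT hi⟩, by simpa using hi⟩)
      refine ⟨v, by simpa using hv, u, fun j hj hjv hju ↦ ?_⟩
      have h₁ := hu ⟨j, hT hj⟩ (by simpa using hj) (fun h ↦ hjv (congr_arg Subtype.val h))
        fun h ↦ hju (congr_arg Subtype.val h)
      have h₂ := hpair v ⟨j, hT hj⟩
      rw [h₁] at h₂
      simpa using h₂
    · intro i hi j hj hij
      rw [not_not] at hij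
      have : Module.IsReflexive ℂ M := .of_isPerfPair P.toLinearMap
      exact P.commute_reflectionPerm ⟨hij, P.pairing_eq_zero_iff.mp hij⟩
    · refine List.nodup_append.mpr ⟨Base.nodup_colorList c true, Base.nodup_colorList c false, ?_⟩
      rintro i hi j hj rfl
      obtain ⟨_, h₁⟩ := Base.mem_colorList.mp hi
      obtain ⟨_, h₂⟩ := Base.mem_colorList.mp hj
      simp [h₁] at h₂
    · intro i
      rw [List.mem_append, Base.mem_colorList, Base.mem_colorList]
      refine ⟨fun h ↦ h.elim (·.1) (·.1), fun h ↦ ?_⟩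
      cases hci : c ⟨i, h⟩
      · exact Or.inr ⟨h, hci⟩
      · exact Or.inl ⟨h, hci⟩
  rw [List.map_append, List.prod_append] at hconj
  obtain ⟨u, hu⟩ := hconj
  rw [hcard, SemiconjBy.orderOf_eq (u : Equiv.Perm ι) hu, P.orderOf_prod_reflectionPerm,
    Module.finrank_eq_card_basis b.toWeightBasis, Fintype.card_coe]

/-! ### Casimir operators and trace forms -/

/-- The duality relation for a pair of families with respect to the Killing form is symmetric. -/
theorem LieAlgebra.IsKilling.eq_sum_killingForm_smul_of_dual {K L κ : Type*} [Field K] [LieRing L]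
    [LieAlgebra K L] [LieAlgebra.IsKilling K L] [Fintype κ] {x y : κ → L}
    (hx : ∀ z, z = ∑ a, killingForm K L (y a) z • x a) (z : L) :
    z = ∑ a, killingForm K L (x a) z • y a := by
  rw [← sub_eq_zero, ← Submodule.mem_bot K, ← LieAlgebra.IsKilling.ker_killingForm_eq_bot K L,
    LinearMap.mem_ker]
  refine LinearMap.ext fun w ↦ ?_
  conv_lhs => rw [hx w]
  have h (a : κ) : killingForm K L (y a) w * killingForm K L z (x a) =
      killingForm K L (x a) z * killingForm K L (y a) w := by
    rw [mul_comm, LieModule.traceForm_comm K L L z]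
  have h' : killingForm K L z w = ∑ a, killingForm K L (x a) z * killingForm K L (y a) w := by
    conv_lhs => rw [hx w]
    simp [h]
  rw [← hx w]
  simp [h']

namespace LieModule

variable {K L V κ : Type*} [Field K] [LieRing L] [LieAlgebra K L]
  [AddCommGroup V] [Module K V] [LieRingModule L V] [LieModule K L V] [Fintype κ]

/-- The Casimir operator `∑ a, x a * y a` attached to families that are dual to each other for the
Killing form commutes with the action of the Lie algebra. -/
theorem lie_sum_lie_lie_of_dual {x y : κ → L}
    (hx : ∀ z, z = ∑ a, killingForm K L (y a) z • x a)
    (hy : ∀ z, z = ∑ a, killingForm K L (x a) z • y a) (z : L) (v : V) :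
    ⁅z, ∑ a, ⁅x a, ⁅y a, v⁆⁆⁆ = ∑ a, ⁅x a, ⁅y a, ⁅z, v⁆⁆⁆ := by
  have h₁ (a : κ) : ⁅⁅z, x a⁆, ⁅y a, v⁆⁆ =
      ∑ b, killingForm K L (y b) ⁅z, x a⁆ • ⁅x b, ⁅y a, v⁆⁆ := by
    conv_lhs => rw [hx ⁅z, x a⁆]
    rw [sum_lie]
    simp only [smul_lie]
  have h₂ (a : κ) : ⁅x a, ⁅⁅z, y a⁆, v⁆⁆ =
      ∑ b, killingForm K L (x b) ⁅z, y a⁆ • ⁅x a, ⁅y b, v⁆⁆ := by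
    conv_lhs => rw [hy ⁅z, y a⁆]
    rw [sum_lie, lie_sum]
    simp only [smul_lie, lie_smul]
  have h₃ (a b : κ) : killingForm K L (y b) ⁅z, x a⁆ + killingForm K L (x a) ⁅z, y b⁆ = 0 := by
    have h : killingForm K L ⁅x a, z⁆ (y b) = killingForm K L (x a) ⁅z, y b⁆ :=
      traceForm_apply_lie_apply K L L (x a) z (y b)
    rw [← h, traceForm_comm K L L (y b), ← lie_skew, map_neg, LinearMap.neg_apply, neg_add_cancel]
  rw [lie_sum]
  calc ∑ a, ⁅z, ⁅x a, ⁅y a, v⁆⁆⁆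
      = ∑ a, ⁅⁅z, x a⁆, ⁅y a, v⁆⁆ + ∑ a, ⁅x a, ⁅⁅z, y a⁆, v⁆⁆ + ∑ a, ⁅x a, ⁅y a, ⁅z, v⁆⁆⁆ := by
        rw [← Finset.sum_add_distrib, ← Finset.sum_add_distrib]
        refine Finset.sum_congr rfl fun a _ ↦ ?_
        rw [leibniz_lie z (x a), leibniz_lie z (y a), lie_add, add_assoc]
    _ = ∑ a, ⁅x a, ⁅y a, ⁅z, v⁆⁆⁆ := by
        simp only [h₁, h₂]
        rw [Finset.sum_comm (f := fun a b ↦ killingForm K L (x b) ⁅z, y a⁆ • ⁅x a, ⁅y b, v⁆⁆),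
          ← Finset.sum_add_distrib, add_eq_right]
        refine Finset.sum_eq_zero fun a _ ↦ ?_
        rw [← Finset.sum_add_distrib]
        refine Finset.sum_eq_zero fun b _ ↦ ?_
        rw [← add_smul, h₃, zero_smul]

/-- In an irreducible module the Casimir operator is the scalar by which it acts on any nonzero
eigenvector. -/
theorem sum_lie_lie_eq_smul_of_dual [LieModule.IsIrreducible K L V] [LieAlgebra.IsKilling K L]
    {x y : κ → L}
    (hx : ∀ z, z = ∑ a, killingForm K L (y a) z • x a) {s : K} {v : V} (hv₀ : v ≠ 0)
    (hv : ∑ a, ⁅x a, ⁅y a, v⁆⁆ = s • v) (u : V) :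
    ∑ a, ⁅x a, ⁅y a, u⁆⁆ = s • u := by
  let Ω : Module.End K V := ∑ a, toEnd K L V (x a) ∘ₗ toEnd K L V (y a)
  have hΩ (u : V) : Ω u = ∑ a, ⁅x a, ⁅y a, u⁆⁆ := by simp [Ω]
  let N : LieSubmodule K L V :=
    { LinearMap.ker (Ω - algebraMap K _ s) with
      lie_mem := fun {z u} hu ↦ by
        have hu : Ω u = s • u := by simpa [sub_eq_zero] using hu
        change (Ω - algebraMap K _ s) ⁅z, u⁆ = 0
        rw [LinearMap.sub_apply, hΩ,
          ← lie_sum_lie_lie_of_dual hx (LieAlgebra.IsKilling.eq_sum_killingForm_smul_of_dual hx),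
          ← hΩ, hu]
        simp }
  have hmem (u : V) : u ∈ N ↔ Ω u = s • u := by
    change (Ω - algebraMap K _ s) u = 0 ↔ _
    simp [sub_eq_zero]
  have hN : N = ⊤ := by
    refine (eq_bot_or_eq_top N).resolve_left fun h ↦ hv₀ ?_
    rw [← LieSubmodule.mem_bot (R := K) (L := L), ← h, hmem, hΩ, hv]
  rw [← hΩ, ← hmem, hN]
  exact LieSubmodule.mem_top u

/-- The trace of the Casimir operator of an irreducible module, expressed by the trace form and by
the eigenvalue `s` on some eigenvector. -/
theorem sum_traceForm_eq_finrank_mul [FiniteDimensional K V]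
    [LieModule.IsIrreducible K L V] [LieAlgebra.IsKilling K L]
    {x y : κ → L}
    (hx : ∀ z, z = ∑ a, killingForm K L (y a) z • x a) {s : K} {v : V} (hv₀ : v ≠ 0)
    (hv : ∑ a, ⁅x a, ⁅y a, v⁆⁆ = s • v) :
    ∑ a, traceForm K L V (x a) (y a) = Module.finrank K V * s := by
  have h : ∑ a, toEnd K L V (x a) ∘ₗ toEnd K L V (y a) = s • (1 : Module.End K V) := by
    refine LinearMap.ext fun u ↦ ?_
    simpa using sum_lie_lie_eq_smul_of_dual hx hv₀ hv u
  simp only [traceForm_apply_apply]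
  rw [← map_sum, h, map_smul, LinearMap.trace_one, smul_eq_mul, mul_comm]

variable (K L V) in
/-- Over an algebraically closed field, every trace form of a simple Lie algebra with nondegenerate
Killing form is a multiple of the Killing form: for an eigenvalue `c` of the endomorphism
relating the two forms, the radical of `traceForm K L V - c • killingForm K L` is a nonzero ideal.
-/
theorem exists_traceForm_eq_smul_killingForm [IsAlgClosed K] [FiniteDimensional K L]
    [LieAlgebra.IsKilling K L] [LieAlgebra.IsSimple K L] :
    ∃ c : K, traceForm K L V = c • killingForm K L := by
  have : Nontrivial L := LieAlgebra.IsSimple.nontrivial K L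
  let κ := killingForm K L
  have hκ : κ.Nondegenerate := LieAlgebra.IsKilling.killingForm_nondegenerate K L
  let f : Module.End K L := (κ.toDual hκ).symm.toLinearMap ∘ₗ traceForm K L V
  obtain ⟨c, hc⟩ := Module.End.exists_eigenvalue f
  obtain ⟨z, hz⟩ := hc.exists_hasEigenvector
  let I : LieIdeal K L :=
    { LinearMap.ker (traceForm K L V - c • κ) with
      lie_mem := fun {u z} hz ↦ by
        have hz' (w : L) : traceForm K L V z w = c * κ z w := by
          have := LinearMap.congr_fun (show (traceForm K L V - c • κ) z = 0 from hz) w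
          simpa [sub_eq_zero] using this
        change (traceForm K L V - c • κ) ⁅u, z⁆ = 0
        refine LinearMap.ext fun w ↦ ?_
        have h₁ := traceForm_apply_lie_apply K L V z u w
        have h₂ : κ ⁅z, u⁆ w = κ z ⁅u, w⁆ := traceForm_apply_lie_apply K L L z u w
        rw [← lie_skew]
        simp only [map_neg, LinearMap.neg_apply, LinearMap.sub_apply, LinearMap.smul_apply, h₁, h₂,
          hz', smul_eq_mul, LinearMap.zero_apply, sub_self, neg_zero] }
  have hI : I ≠ ⊥ := by
    intro h
    have hzI : z ∈ I := by
      change (traceForm K L V - c • κ) z = 0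
      have := congr_arg (κ.toDual hκ) hz.apply_eq_smul
      simp only [f, LinearMap.coe_comp, LinearEquiv.coe_coe, Function.comp_apply,
        LinearEquiv.apply_symm_apply, map_smul] at this
      refine sub_eq_zero.mpr (this.trans ?_)
      rfl
    rw [h, LieSubmodule.mem_bot] at hzI
    exact hz.2 hzI
  have hI' : I = ⊤ := (LieAlgebra.IsSimple.eq_bot_or_eq_top I).resolve_left hI
  refine ⟨c, ?_⟩
  ext z w
  have hz : z ∈ I := hI' ▸ LieSubmodule.mem_top z
  have := LinearMap.congr_fun (show (traceForm K L V - c • κ) z = 0 from hz) w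
  simpa [sub_eq_zero] using this

end LieModule

/-! ### Dual families adapted to a Cartan subalgebra -/

section

open LieModule Module

namespace LieAlgebra

variable {L : Type*} [LieRing L] [LieAlgebra ℂ L] [FiniteDimensional ℂ L] [IsKilling ℂ L]
  (H : LieSubalgebra ℂ L) [H.IsCartanSubalgebra]

/-- Root vectors `e α` and `f α` for `α` and `-α`, dual for the Killing form. -/
theorem exists_rootVector_families :
    ∃ e f : H.root → L, (∀ α, e α ∈ rootSpace H α.1) ∧ (∀ α, f α ∈ rootSpace H (-α.1)) ∧
      ∀ α, killingForm ℂ L (e α) (f α) = 1 := by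
  have key (α : H.root) : ∃ e f : L, e ∈ rootSpace H α.1 ∧ f ∈ rootSpace H (-α.1) ∧
      killingForm ℂ L e f = 1 := by
    obtain ⟨e, he, he₀⟩ := α.1.exists_ne_zero
    obtain ⟨f, hf, hef⟩ : ∃ f ∈ rootSpace H (-α.1), killingForm ℂ L e f ≠ 0 := by
      contrapose! he₀
      simpa using mem_ker_killingForm_of_mem_rootSpace_of_forall_rootSpace_neg ℂ L H he he₀
    exact ⟨e, (killingForm ℂ L e f)⁻¹ • f, he, Submodule.smul_mem _ _ hf, by simp [hef]⟩
  choose e f h₁ h₂ h₃ using key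
  exact ⟨e, f, h₁, h₂, h₃⟩

variable {H}

/-- A family in a Cartan subalgebra together with a family of vectors indexed by the roots. It
is used with a basis of `H` and with one root vector for each root. -/
noncomputable def rootFamily {κ : Type*} (b : κ → H) (e : H.root → L) : κ ⊕ H.root → L :=
  Sum.elim (fun i ↦ (b i : L)) e

section

variable {κ : Type*} [Fintype κ] [DecidableEq κ]

variable (H) in
/-- The basis of a Cartan subalgebra dual to a given one with respect to the Killing form. -/
noncomputable def cartanDualBasis (b : Module.Basis κ ℂ H) : Module.Basis κ ℂ H :=
  (traceForm ℂ H L).dualBasis (IsKilling.traceForm_cartan_nondegenerate ℂ L H) b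

theorem traceForm_cartanDualBasis (b : Module.Basis κ ℂ H) (i j : κ) :
    traceForm ℂ H L (b i) (cartanDualBasis H b j) = if i = j then 1 else 0 :=
  LinearMap.BilinForm.apply_dualBasis_right _ ⟨traceForm_comm ℂ H L⟩ _ _ _

theorem eq_sum_traceForm_cartanDualBasis_smul (b : Module.Basis κ ℂ H) (z : H) :
    z = ∑ i, traceForm ℂ H L (cartanDualBasis H b i) z • b i := by
  have hB := IsKilling.traceForm_cartan_nondegenerate ℂ L H
  have h := LinearMap.BilinForm.dualBasis_dualBasis hB ⟨traceForm_comm ℂ H L⟩ b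
  conv_lhs => rw [← b.sum_repr z]
  refine Finset.sum_congr rfl fun i _ ↦ ?_
  congr 1
  conv_lhs => rw [← h]
  rw [LinearMap.BilinForm.dualBasis_repr_apply, traceForm_comm]
  rfl

/-- A basis of `H` with its dual basis, and root vectors `e α` with the dual root vectors `f α`, are
dual families for the Killing form of `L`. -/
theorem eq_sum_killingForm_smul_rootFamily (b : Module.Basis κ ℂ H) {e f : H.root → L}
    (he : ∀ α, e α ∈ rootSpace H α.1) (hf : ∀ α, f α ∈ rootSpace H (-α.1))
    (hef : ∀ α, killingForm ℂ L (e α) (f α) = 1) (z : L) :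
    z = ∑ a, killingForm ℂ L (rootFamily (cartanDualBasis H b) f a) z • rootFamily b e a := by
  simp only [Fintype.sum_sum_type, rootFamily, Sum.elim_inl, Sum.elim_inr]
  have hz : z ∈ ⨆ χ : Weight ℂ H L, genWeightSpace L χ := by
    rw [iSup_genWeightSpace_eq_top' ℂ H L]; exact LieSubmodule.mem_top z
  induction hz using LieSubmodule.iSup_induction' with
  | mem χ z hz =>
    have hH (h : H) : (h : L) ∈ rootSpace H (0 : H → ℂ) := by simp
    by_cases hχ : χ.IsZero
    · have hz' : z ∈ rootSpace H (0 : H → ℂ) := by rwa [← show (χ : H → ℂ) = 0 from hχ]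
      have hzH : z ∈ H := by simpa using hz'
      have h₂ : ∑ α, killingForm ℂ L (f α) z • e α = 0 := by
        refine Finset.sum_eq_zero fun α _ ↦ ?_
        rw [killingForm_apply_eq_zero_of_mem_rootSpace_of_add_ne_zero ℂ L H (hf α) hz', zero_smul]
        rw [add_zero, neg_ne_zero]
        exact LieSubalgebra.isNonZero_coe_root α
      rw [h₂, add_zero]
      have h := congr_arg (Subtype.val) (eq_sum_traceForm_cartanDualBasis_smul b ⟨z, hzH⟩)
      conv_lhs => rw [show z = ((⟨z, hzH⟩ : H) : L) from rfl, h]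
      rw [AddSubmonoidClass.coe_finsetSum]
      rfl
    · have h₁ : ∑ i, killingForm ℂ L (cartanDualBasis H b i : L) z • (b i : L) = 0 := by
        refine Finset.sum_eq_zero fun i _ ↦ ?_
        rw [killingForm_apply_eq_zero_of_mem_rootSpace_of_add_ne_zero ℂ L H (hH _) hz, zero_smul]
        rwa [zero_add]
      rw [h₁, zero_add]
      let α₀ : H.root := ⟨χ, by simpa using hχ⟩
      rw [Finset.sum_eq_single α₀]
      · have h1 := IsKilling.finrank_rootSpace_eq_one χ hχ
        have he₀ : (⟨e α₀, he α₀⟩ : rootSpace H χ) ≠ 0 := by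
          intro h
          have h := congr_arg Subtype.val h
          have := hef α₀
          simp only [LieSubmodule.coe_zero] at h
          simp [h] at this
        obtain ⟨t, ht⟩ := exists_smul_eq_of_finrank_eq_one h1 he₀ ⟨z, hz⟩
        have ht : t • e α₀ = z := congr_arg Subtype.val ht
        rw [← ht, map_smul, traceForm_comm, hef, smul_eq_mul, mul_one]
      · intro α _ hα
        rw [killingForm_apply_eq_zero_of_mem_rootSpace_of_add_ne_zero ℂ L H (hf α) hz, zero_smul]
        intro h
        refine hα (Subtype.ext (DFunLike.coe_injective ?_))
        exact (neg_add_eq_zero.mp h)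
      · simp
  | zero => simp
  | add x y _ _ hx hy =>
    conv_lhs => rw [hx, hy]
    simp only [map_add, add_smul, Finset.sum_add_distrib]
    abel

/-- The pairings of the dual families sum to the dimension of `L`, which here appears as the rank
plus the number of roots. -/
theorem sum_killingForm_rootFamily (b : Module.Basis κ ℂ H) {e f : H.root → L}
    (hef : ∀ α, killingForm ℂ L (e α) (f α) = 1) :
    ∑ a, killingForm ℂ L (rootFamily b e a) (rootFamily (cartanDualBasis H b) f a) =
      Fintype.card κ + Nat.card H.root := by
  have h (i : κ) : killingForm ℂ L (b i) (cartanDualBasis H b i) = 1 :=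
    (traceForm_cartanDualBasis b i i).trans (if_pos rfl)
  simp only [Fintype.sum_sum_type, rootFamily, Sum.elim_inl, Sum.elim_inr, h, hef,
    Finset.sum_const, Finset.card_univ, nsmul_one, Nat.card_eq_fintype_card]

theorem dualKillingForm_apply (μ ν : Dual ℂ H) :
    dualKillingForm H μ ν = μ ((IsKilling.cartanEquivDual H).symm ν) :=
  LinearMap.BilinForm.apply_toDual_symm_apply
    (hB := IsKilling.traceForm_cartan_nondegenerate ℂ L H) _ _

theorem dualKillingForm_eq_sum (b : Module.Basis κ ℂ H) (μ ν : Dual ℂ H) :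
    dualKillingForm H μ ν = ∑ i, μ (b i) * ν (cartanDualBasis H b i) := by
  rw [dualKillingForm_apply, eq_sum_traceForm_cartanDualBasis_smul b
    ((IsKilling.cartanEquivDual H).symm ν), map_sum]
  refine Finset.sum_congr rfl fun i _ ↦ ?_
  have : traceForm ℂ H L ((IsKilling.cartanEquivDual H).symm ν) (cartanDualBasis H b i) =
      ν (cartanDualBasis H b i) :=
    LinearMap.BilinForm.apply_toDual_symm_apply
      (hB := IsKilling.traceForm_cartan_nondegenerate ℂ L H) _ _
  rw [map_smul, traceForm_comm, this, smul_eq_mul, mul_comm]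

end

/-! ### Highest weights and weight spaces -/

variable {V : Type*} [AddCommGroup V] [Module ℂ V] [LieRingModule L V] [LieModule ℂ L V]

/-- The Casimir operator multiplies a vector of weight `lam` killed by the positive root spaces by
`⟨lam, lam + 2ρ⟩`. -/
theorem sum_lie_lie_rootFamily_of_isPos_lie_eq_zero (b : (IsKilling.rootSystem H).Base)
    {lam : Dual ℂ H} {v : V} (hv : v ∈ weightSpace V (lam : H → ℂ))
    (hpos : ∀ i, b.IsPos i → ∀ x ∈ rootSpace H ((IsKilling.rootSystem H).root i), ⁅x, v⁆ = 0)
    {κ : Type*} [Fintype κ] [DecidableEq κ] (u : Module.Basis κ ℂ H) {e f : H.root → L}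
    (he : ∀ α, e α ∈ rootSpace H α.1) (hf : ∀ α, f α ∈ rootSpace H (-α.1))
    (hef : ∀ α, killingForm ℂ L (e α) (f α) = 1) :
    ∑ a, ⁅rootFamily u e a, ⁅rootFamily (cartanDualBasis H u) f a, v⁆⁆ =
      dualKillingForm H lam (lam + 2 • halfSumPositiveRoots b) • v := by
  classical
  rw [mem_weightSpace] at hv
  have hv' (h : H) : ⁅(h : L), v⁆ = lam h • v := hv h
  simp only [Fintype.sum_sum_type, rootFamily, Sum.elim_inl, Sum.elim_inr]
  have h₁ : ∑ i, ⁅(u i : L), ⁅(cartanDualBasis H u i : L), v⁆⁆ = dualKillingForm H lam lam • v := by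
    rw [dualKillingForm_eq_sum u, Finset.sum_smul]
    refine Finset.sum_congr rfl fun i _ ↦ ?_
    rw [hv', lie_smul, hv', smul_smul, mul_comm]
  have h₂ (α : H.root) : ⁅e α, ⁅f α, v⁆⁆ =
      if b.IsPos α then dualKillingForm H lam ((IsKilling.rootSystem H).root α) • v else 0 := by
    split_ifs with hα
    -- For positive `α`, `e f v = [e, f] v` as `e v = 0`; for negative `α`, `f v = 0`.
    · have hev : ⁅e α, v⁆ = 0 := hpos α hα _ (by simpa using he α)
      rw [leibniz_lie, hev, lie_zero, add_zero,
        IsKilling.lie_eq_killingForm_smul_of_mem_rootSpace_of_mem_rootSpace_neg (he α) (hf α), hef,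
        one_smul, hv', dualKillingForm_apply]
      simp
    · rw [← b.isPos_reflectionPerm_self_iff] at hα
      have := hpos _ hα (f α) (by
        rw [RootPairing.root_reflectionPerm, RootPairing.reflection_apply_self]
        simpa using hf α)
      rw [this, lie_zero]
  rw [h₁, Finset.sum_congr rfl fun α _ ↦ h₂ α, map_add, add_smul]
  congr 1
  rw [halfSumPositiveRoots, ← Nat.cast_smul_eq_nsmul ℂ, smul_smul]
  norm_num
  rw [Finset.sum_smul, Finset.sum_filter]

variable (H V) in
/-- The trace form of `V` on a basis of `H` and its dual sums to the weighted sum of the squared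
lengths of the weights. -/
theorem sum_traceForm_cartanDualBasis [FiniteDimensional ℂ V]
    {κ : Type*} [Fintype κ] [DecidableEq κ] (u : Module.Basis κ ℂ H) :
    ∑ i, traceForm ℂ H V (u i) (cartanDualBasis H u i) =
      ∑ μ : Weight ℂ H V, (finrank ℂ (genWeightSpace V μ) : ℂ) *
        dualKillingForm H μ.toLinear μ.toLinear := by
  have h (μ : Weight ℂ H V) : (finrank ℂ (genWeightSpace V μ) : ℂ) *
        dualKillingForm H μ.toLinear μ.toLinear =
      ∑ i, finrank ℂ (genWeightSpace V μ) • (μ (u i) * μ (cartanDualBasis H u i)) := by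
    rw [dualKillingForm_eq_sum u, Finset.mul_sum]
    simp
  simp only [h, traceForm_eq_sum_finrank_nsmul_mul]
  rw [Finset.sum_comm]

theorem lie_mem_weightSpace_add_of_mem_rootSpace {α χ : H → ℂ} {x : L} {v : V}
    (hx : x ∈ rootSpace H α) (hv : v ∈ weightSpace V χ) : ⁅x, v⁆ ∈ weightSpace V (α + χ) := by
  rw [mem_weightSpace] at hv ⊢
  intro h
  have hv : ⁅(h : L), v⁆ = χ h • v := hv h
  have hx : ⁅(h : L), x⁆ = α h • x := IsKilling.lie_eq_smul_of_mem_rootSpace hx h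
  change ⁅(h : L), ⁅x, v⁆⁆ = _
  rw [leibniz_lie, hv, hx, smul_lie, lie_smul, Pi.add_apply, add_smul]

variable [LieModule.IsIrreducible ℂ L V]

/-- The sum of the weight spaces is stable under `L`, so an irreducible module with a weight vector
is the sum of its weight spaces. -/
theorem iSup_weightSpace_eq_top {χ₀ : H → ℂ} {v : V} (hv₀ : v ≠ 0) (hv : v ∈ weightSpace V χ₀) :
    ⨆ χ : H → ℂ, weightSpace V χ = ⊤ := by
  let N : LieSubmodule ℂ L V :=
    { (⨆ χ : H → ℂ, weightSpace V χ).toSubmodule with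
      lie_mem := fun {x u} hu ↦ by
        change u ∈ ⨆ χ : H → ℂ, weightSpace V χ at hu
        change ⁅x, u⁆ ∈ ⨆ χ : H → ℂ, weightSpace V χ
        have hx : x ∈ ⨆ χ : H → ℂ, rootSpace H χ := by
          rw [iSup_genWeightSpace_eq_top ℂ H L]; exact LieSubmodule.mem_top x
        induction hu using LieSubmodule.iSup_induction' with
        | mem χ u hu =>
          induction hx using LieSubmodule.iSup_induction' with
          | mem α x hx =>
            exact (le_iSup (fun χ : H → ℂ ↦ weightSpace V χ) (α + χ))
              (lie_mem_weightSpace_add_of_mem_rootSpace hx hu)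
          | zero => rw [zero_lie]; exact zero_mem _
          | add x y _ _ hx hy => rw [add_lie]; exact add_mem hx hy
        | zero => rw [lie_zero]; exact zero_mem _
        | add u v _ _ hu hv => rw [lie_add]; exact add_mem hu hv }
  have hN : N = ⊤ := by
    refine (eq_bot_or_eq_top N).resolve_left fun h ↦ hv₀ ?_
    rw [← LieSubmodule.mem_bot (R := ℂ) (L := L), ← h]
    exact (le_iSup (fun χ : H → ℂ ↦ weightSpace V χ) χ₀) hv
  refine eq_top_iff.mpr fun u _ ↦ ?_
  have : u ∈ N := hN ▸ LieSubmodule.mem_top u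
  exact this

/-- A Cartan subalgebra acts semisimply on an irreducible module that contains a weight vector: the
weight spaces already span, and the generalized ones are independent. -/
theorem weightSpace_eq_genWeightSpace {χ₀ : H → ℂ} {v : V} (hv₀ : v ≠ 0)
    (hv : v ∈ weightSpace V χ₀) (μ : H → ℂ) : weightSpace V μ = genWeightSpace V μ := by
  have htop := iSup_weightSpace_eq_top hv₀ hv
  rw [iSup_split_single _ μ] at htop
  refine eq_of_le_of_inf_le_of_sup_le (z := ⨆ χ, ⨆ (_ : χ ≠ μ), weightSpace V χ)
    (weightSpace_le_genWeightSpace V μ) ?_ (by rw [htop]; exact le_top)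
  have h := iSupIndep_genWeightSpace ℂ H V μ
  refine le_trans (le_of_eq (disjoint_iff.mp (h.mono_right ?_))) bot_le
  exact iSup₂_mono fun χ _ ↦ weightSpace_le_genWeightSpace V χ

end LieAlgebra

end

/-! ### The expected norm of a weight -/

theorem theorem1
    {L : Type*} [LieRing L] [LieAlgebra ℂ L] [FiniteDimensional ℂ L] [LieAlgebra.IsSimple ℂ L]
    (H : LieSubalgebra ℂ L) [H.IsCartanSubalgebra]
    (b : (LieAlgebra.IsKilling.rootSystem H).Base)
    (V : Type*) [AddCommGroup V] [Module ℂ V] [LieRingModule L V] [LieModule ℂ L V]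
    [FiniteDimensional ℂ V] [LieModule.IsIrreducible ℂ L V]
    (lam : Module.Dual ℂ H) (hlam : LieAlgebra.IsHighestWeight b V lam)
    -- `B` is the form induced by the Killing form, up to an arbitrary normalization
    (B : LinearMap.BilinForm ℂ (Module.Dual ℂ H))
    (hB : ∃ c : ℂ, B = c • LieAlgebra.dualKillingForm H)
    -- `orderOf w` is the Coxeter number
    (w : Module.Dual ℂ H ≃ₗ[ℂ] Module.Dual ℂ H)
    (hw : (LieAlgebra.IsKilling.rootSystem H).IsCoxeterElement w) :
    1 / (Module.finrank ℂ V : ℂ) *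
        ∑ μ : LieModule.Weight ℂ H V,
          (Module.finrank ℂ (LieModule.weightSpace V μ) : ℂ) * B μ.toLinear μ.toLinear =
      1 / ((orderOf w : ℂ) + 1) *
        B lam (lam + 2 • LieAlgebra.halfSumPositiveRoots b) := by
  obtain ⟨k, rfl⟩ := hB
  obtain ⟨v, hv, hv₀, hpos⟩ := hlam
  obtain ⟨c, hc⟩ := LieModule.exists_traceForm_eq_smul_killingForm ℂ L V
  obtain ⟨e, f, he, hf, hef⟩ := LieAlgebra.exists_rootVector_families H
  let u := Module.finBasis ℂ H
  set s := LieAlgebra.dualKillingForm H lam (lam + 2 • LieAlgebra.halfSumPositiveRoots b) with hs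
  -- Two values of the trace of the Casimir operator: `c * (n + h * n)` and `finrank V * s`.
  have htrace := LieModule.sum_traceForm_eq_finrank_mul
    (LieAlgebra.eq_sum_killingForm_smul_rootFamily u he hf hef) hv₀
    (LieAlgebra.sum_lie_lie_rootFamily_of_isPos_lie_eq_zero b hv hpos u he hf hef)
  rw [hc] at htrace
  simp only [LinearMap.smul_apply, smul_eq_mul, ← Finset.mul_sum] at htrace
  rw [LieAlgebra.sum_killingForm_rootFamily u hef, Fintype.card_fin, hw.card_eq_orderOf_mul_finrank,
    Subspace.dual_finrank_eq, ← hs] at htrace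
  have hsum := LieAlgebra.sum_traceForm_cartanDualBasis H V u
  have hn : ∑ i, LieModule.traceForm ℂ H V (u i) (LieAlgebra.cartanDualBasis H u i) =
      c * Module.finrank ℂ H := by
    have h (i) : LieModule.traceForm ℂ H V (u i) (LieAlgebra.cartanDualBasis H u i) = c := by
      calc LieModule.traceForm ℂ H V (u i) (LieAlgebra.cartanDualBasis H u i)
          = LieModule.traceForm ℂ L V (u i) (LieAlgebra.cartanDualBasis H u i) := rfl
        _ = c * LieModule.traceForm ℂ H L (u i) (LieAlgebra.cartanDualBasis H u i) := by
          rw [hc]; rfl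
        _ = c := by rw [LieAlgebra.traceForm_cartanDualBasis, if_pos rfl, mul_one]
    simp [h, mul_comm]
  rw [hn] at hsum
  have hV : (Module.finrank ℂ V : ℂ) ≠ 0 := by
    have : Nontrivial V := ⟨v, 0, hv₀⟩
    exact_mod_cast Module.finrank_pos.ne'
  have hw₁ : (orderOf w : ℂ) + 1 ≠ 0 := Nat.cast_add_one_ne_zero _
  have hS : ∑ μ : LieModule.Weight ℂ H V, (Module.finrank ℂ (LieModule.weightSpace V μ) : ℂ) *
      (k • LieAlgebra.dualKillingForm H) μ.toLinear μ.toLinear = k * (c * Module.finrank ℂ H) := by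
    rw [hsum, Finset.mul_sum]
    refine Finset.sum_congr rfl fun μ _ ↦ ?_
    rw [LieAlgebra.weightSpace_eq_genWeightSpace hv₀ hv]
    simp only [LinearMap.smul_apply, smul_eq_mul]
    ring
  rw [hS, LinearMap.smul_apply, LinearMap.smul_apply, ← hs, smul_eq_mul]
  push_cast at htrace
  field_simp
  linear_combination k * htrace
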